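/- For positive integers $n,p,k$ and reals $\tau,\sigma>0$, consider the linear regression model $$y_i=x_i^{T}\beta+\sigma z_i,\qquad i=1,\dots,n,$$ where $\beta\in\mathbb R^p$ is unknown, the covariates $x_1,\dots,x_n$ are i.i.d. $\mathcal N(0,\tfrac1n I_p)$, and the errors $z_1,\dots,z_n$ are i.i.d. $\mathcal N(0,1)$ and independent of the covariates. Let $\mathbb E_\beta$ denote expectation under this model, let $\|\beta\|_0$ be the number of non-zero coordinates of $\beta$, and put $$\Theta(k,\tau)=\{\beta\in\mathbb R^p:\ \|\beta\|_0\le k,\ \|\beta\|_2^2\le k\tau^2\},\qquad R(\Theta(k,\tau),\sigma)=\inf_{\hat\beta}\ \sup_{\beta\in\Theta(k,\tau)}\mathbb E_\beta\|\hat\beta-\beta\|_2^2,$$ the infimum being over all measurable functions $\hat\beta$ of the data $(x_i,y_i)_{i\le n}$ with values in $\mathbb R^p$. For $\lambda>0$ let $\hat\beta^{R}(\lambda)\in\arg\min_{b\in\mathbb R^p}\sum_{i=1}^n(y_i-x_i^Tb)^2+\lambda\|b\|_2^2$ be the ridge regression estimator. **Theorem.** Let $p=p_n\ge1$ and $k=k_n\ge1$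 be integers and $\tau=\tau_n>0$, $\sigma=\sigma_n>0$ reals such that, as $n\to\infty$, $k/p\to0$, $k/n\to0$ and $\tau/\sigma\to0$. Then, as $n\to\infty$, $$R(\Theta(k,\tau),\sigma)=k\tau^2\Big(1-\frac{k\tau^2}{p\sigma^2}\,(1+o(1))\Big).$$ Moreover, with $\lambda=p\sigma^2/(k\tau^2)$, the ridge estimator attains this second-order expansion: $$\sup_{\beta\in\Theta(k,\tau)}\mathbb E_\beta\|\hat\beta^{R}(\lambda)-\beta\|_2^2=k\tau^2\Big(1-\frac{k\tau^2}{p\sigma^2}\,(1+o(1))\Big).$$ -/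

import Mathlib

open MeasureTheory ProbabilityTheory Filter Topology
open scoped ENNReal NNReal Matrix

namespace SparseRegression

/-- An observed data set `(X, y)`: the rows `x_1, …, x_n ∈ ℝ^p` of the design and the
responses `y_1, …, y_n`. -/
abbrev Data (n p : ℕ) : Type := (Fin n → Fin p → ℝ) × (Fin n → ℝ)

/-- An estimator of `β ∈ ℝ^p`: a function of the data (measurability is imposed separately). -/
abbrev Estimator (n p : ℕ) : Type := Data n p → EuclideanSpace ℝ (Fin p)

/-- The law of the design: the rows `x_1, …, x_n` are i.i.d. `N(0, (1/n) I_p)`, that is, all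
entries are i.i.d. `N(0, 1/n)`. -/
noncomputable def designLaw (n p : ℕ) : Measure (Fin n → Fin p → ℝ) :=
  Measure.pi fun _ => Measure.pi fun _ => gaussianReal 0 ((n : ℝ≥0)⁻¹)

/-- The law of the errors `z_1, …, z_n`: i.i.d. `N(0, 1)`. -/
noncomputable def noiseLaw (n : ℕ) : Measure (Fin n → ℝ) :=
  Measure.pi fun _ => gaussianReal 0 1

/-- The responses `y_i = x_iᵀ β + σ z_i`. -/
noncomputable def response {n p : ℕ} (σ : ℝ) (β : EuclideanSpace ℝ (Fin p))
    (X : Fin n → Fin p → ℝ) (z : Fin n → ℝ) : Fin n → ℝ :=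
  fun i => X i ⬝ᵥ β.ofLp + σ * z i

/-- The mean squared error `E_β ‖β̂ - β‖₂²` (possibly infinite), the design and the errors being
independent. -/
noncomputable def risk {n p : ℕ} (σ : ℝ) (est : Estimator n p)
    (β : EuclideanSpace ℝ (Fin p)) : ℝ≥0∞ :=
  ∫⁻ ω, ‖est (ω.1, response σ β ω.1 ω.2) - β‖ₑ ^ 2 ∂((designLaw n p).prod (noiseLaw n))

/-- The parameter space `Θ(k, τ) = {β ∈ ℝ^p : ‖β‖₀ ≤ k, ‖β‖₂² ≤ k τ²}`. -/
def paramSpace (p k : ℕ) (τ : ℝ) : Set (EuclideanSpace ℝ (Fin p)) :=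
  {β | hammingNorm β.ofLp ≤ k ∧ ‖β‖ ^ 2 ≤ k * τ ^ 2}

/-- The worst-case risk of an estimator over `Θ(k, τ)`. -/
noncomputable def supRisk {n p : ℕ} (k : ℕ) (τ σ : ℝ) (est : Estimator n p) : ℝ≥0∞ :=
  ⨆ β ∈ paramSpace p k τ, risk σ est β

/-- The minimax risk `R(Θ(k, τ), σ)`: the infimum, over all measurable (non-randomized)
estimators, of the
worst-case risk. -/
noncomputable def snrMinimaxRisk (n p k : ℕ) (τ σ : ℝ) : ℝ≥0∞ :=
  ⨅ (est : Estimator n p) (_ : Measurable est), supRisk k τ σ est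

/-- The ridge objective `∑_i (y_i - x_iᵀ b)² + lam ‖b‖₂²`. -/
noncomputable def ridgeObjective {n p : ℕ} (lam : ℝ) (D : Data n p)
    (b : EuclideanSpace ℝ (Fin p)) : ℝ :=
  (∑ i, (D.2 i - D.1 i ⬝ᵥ b.ofLp) ^ 2) + lam * ‖b‖ ^ 2

/-- `est` is a ridge estimator with tuning `lam`: on every data set its value minimizes the ridge
objective over `ℝ^p`. -/
def IsRidgeEstimator {n p : ℕ} (lam : ℝ) (est : Estimator n p) : Prop :=
  ∀ D : Data n p, IsMinOn (ridgeObjective lam D) Set.univ (est D)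

end SparseRegression

/-! Write `r = k τ² / (p σ²)`. The minimax risk is at most the worst-case risk of the ridge
estimator, so it suffices to bound the latter from above and the former from below by
`k τ² (1 - r (1 + o(1)))`.

*Upper bound.* The ridge estimator with tuning `lam = 1 / r` has bias `-lam (XᵀX + lam)⁻¹ β` and
noise term `σ (XᵀX + lam)⁻¹ Xᵀ z`. Since `E XᵀX = I`, the squared bias is at most
`‖β‖² (1 - 2 r) + O(r²) E ‖XᵀX β‖²`, and the variance is at most `r² σ² p = r k τ²`, so that exactly
one of the two terms `r k τ²` gained in the bias is lost again.

*Lower bound.* Partition the coordinates into blocks of almost equal size and put a prior on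
`Θ(k, τ)` that places in each block one spike of random position and sign. Given the other blocks,
the data are a mixture of Gaussian shifts, and by the Cameron–Martin formula the Bayes risk in a
block of `m` coordinates with spikes of size `t` is at least `t² (1 - E[sinh u exp(u / 2)] / m)`,
where `u` is `(t / σ)²` times the squared norm of a column of `X`. As `E u = (t / σ)²`, this is
`t² (1 - (t / σ)² (1 + o(1)) / m)`. With `t² = k τ² m / p` the relative loss `(t / σ)² / m` equals
`r` in every block, and the energies `t²` add up to `k τ²`. -/

namespace SparseRegression

section ProductMeasure

variable {ι : Type*} [Fintype ι] {α : ι → Type*} [∀ i, MeasurableSpace (α i)]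
  {μ : ∀ i, Measure (α i)} [∀ i, IsProbabilityMeasure (μ i)] {g : ∀ i, α i → ℝ≥0∞}

lemma lintegral_prod_eval_pi (hg : ∀ i, Measurable (g i)) :
    ∫⁻ x, ∏ i, g i (x i) ∂Measure.pi μ = ∏ i, ∫⁻ y, g i y ∂μ i := by
  rw [lintegral_prod_eq_prod_lintegral_of_indepFun Finset.univ
    (fun i (x : ∀ i, α i) => g i (x i))
    (iIndepFun_pi fun i => (hg i).aemeasurable) fun i => (hg i).comp (measurable_pi_apply i)]
  exact Finset.prod_congr rfl fun i _ => (measurePreserving_eval μ i).lintegral_comp (hg i)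

lemma pi_withDensity [∀ i, SigmaFinite ((μ i).withDensity (g i))] (hg : ∀ i, Measurable (g i)) :
    Measure.pi (fun i => (μ i).withDensity (g i)) =
      (Measure.pi μ).withDensity fun x => ∏ i, g i (x i) := by
  classical
  refine Measure.pi_eq fun s hs => ?_
  have indicator_prod (x : ∀ i, α i) : (Set.univ.pi s).indicator (fun x => ∏ i, g i (x i)) x =
      ∏ i, (s i).indicator (g i) (x i) := by
    simp only [Set.indicator_apply, Finset.prod_ite_zero, Set.mem_pi, Set.mem_univ,
      Finset.mem_univ, true_implies]
  rw [withDensity_apply _ (.univ_pi hs), ← lintegral_indicator (.univ_pi hs)]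
  simp only [indicator_prod]
  rw [lintegral_prod_eval_pi fun i => (hg i).indicator (hs i)]
  exact Finset.prod_congr rfl fun i _ => by
    rw [lintegral_indicator (hs i), withDensity_apply _ (hs i)]

end ProductMeasure

section RealGaussian

lemma integral_pow_four_gaussianReal (v : ℝ≥0) : ∫ x, x ^ 4 ∂gaussianReal 0 v = 3 * v ^ 2 := by
  rcases eq_or_ne v 0 with rfl | hv
  · simp
  have : (0 : ℝ) < v := by positivity
  have half_line : ∫ x in Set.Ioi (0 : ℝ), x ^ 4 * Real.exp (-(2 * (v : ℝ))⁻¹ * x ^ 2) =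
      (2 * v) ^ 2 * √(2 * v) * (1 / 2) * (3 / 4 * √Real.pi) := by
    have h := integral_rpow_mul_exp_neg_mul_rpow (p := 2) (q := 4) (b := (2 * (v : ℝ))⁻¹)
      two_pos (by norm_num) (by positivity)
    have hGamma : Real.Gamma ((4 + 1) / 2) = 3 / 4 * √Real.pi := by
      have h := Real.Gamma_nat_add_half 2
      norm_num [Nat.doubleFactorial] at h ⊢
      linarith
    have hpow : ((2 * (v : ℝ))⁻¹) ^ (-(4 + 1) / 2 : ℝ) = (2 * v) ^ 2 * √(2 * v) := by
      rw [Real.inv_rpow (by positivity), ← Real.rpow_neg (by positivity),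
        show -(-(4 + 1) / 2 : ℝ) = 2 + 1 / 2 by norm_num, Real.rpow_add (by positivity),
        ← Real.sqrt_eq_rpow, Real.rpow_two]
    rw [hGamma, hpow] at h
    exact_mod_cast h
  have density (x : ℝ) : gaussianPDFReal 0 v x * x ^ 4 =
      (√(2 * Real.pi * v))⁻¹ * (|x| ^ 4 * Real.exp (-(2 * (v : ℝ))⁻¹ * |x| ^ 2)) := by
    rw [gaussianPDFReal, sq_abs, (show Even 4 by decide).pow_abs]
    ring_nf
  rw [integral_gaussianReal_eq_integral_smul hv]
  simp only [smul_eq_mul, density]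
  rw [integral_const_mul,
    integral_comp_abs (f := fun x => x ^ 4 * Real.exp (-(2 * (v : ℝ))⁻¹ * x ^ 2)), half_line,
    show 2 * Real.pi * v = 2 * v * Real.pi by ring, Real.sqrt_mul (by positivity)]
  field_simp
  ring

lemma gaussianPDFReal_mul_exp_mul_sq {v : ℝ≥0} (hv : v ≠ 0) (t x : ℝ) :
    gaussianPDFReal 0 v x * Real.exp (t * x ^ 2) =
      (√(2 * Real.pi * v))⁻¹ * Real.exp (-((1 - 2 * t * v) / (2 * v)) * x ^ 2) := by
  rw [gaussianPDFReal, mul_assoc, ← Real.exp_add]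
  congr 2
  field_simp
  ring

lemma integrable_exp_mul_sq_gaussianReal {v : ℝ≥0} (hv : v ≠ 0) {t : ℝ} (ht : 2 * t * v < 1) :
    Integrable (fun x => Real.exp (t * x ^ 2)) (gaussianReal 0 v) := by
  have hb : 0 < (1 - 2 * t * v) / (2 * v) := div_pos (by linarith) (by positivity)
  rw [gaussianReal_of_var_ne_zero _ hv, gaussianPDF_def,
    integrable_withDensity_iff_integrable_smul' (by fun_prop) (by simp)]
  simp only [ENNReal.toReal_ofReal (gaussianPDFReal_nonneg _ _ _), smul_eq_mul,
    gaussianPDFReal_mul_exp_mul_sq hv]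
  exact (integrable_exp_neg_mul_sq hb).const_mul _

lemma integral_exp_mul_sq_gaussianReal {v : ℝ≥0} (hv : v ≠ 0) {t : ℝ} (ht : 2 * t * v < 1) :
    ∫ x, Real.exp (t * x ^ 2) ∂gaussianReal 0 v = (√(1 - 2 * t * v))⁻¹ := by
  have : 1 - 2 * t * v ≠ 0 := by linarith
  rw [integral_gaussianReal_eq_integral_smul hv]
  simp only [smul_eq_mul, gaussianPDFReal_mul_exp_mul_sq hv]
  rw [integral_const_mul, integral_gaussian, ← Real.sqrt_inv, ← Real.sqrt_inv,
    ← Real.sqrt_mul (by positivity)]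
  congr 1
  field_simp

end RealGaussian

section GaussianVector

variable {ι : Type*} [Fintype ι]

/-- The law of a centred Gaussian vector indexed by `ι` whose coordinates are independent with
variance `v`, as a measure on the plain function space `ι → ℝ`, the type of the rows of the design
and of the errors. -/
noncomputable abbrev iidGaussian (ι : Type*) [Fintype ι] (v : ℝ≥0) : Measure (ι → ℝ) :=
  Measure.pi fun _ => gaussianReal 0 v

@[fun_prop]
lemma measurable_dotProduct {α : Type*} [MeasurableSpace α] {f g : α → ι → ℝ}
    (hf : Measurable f) (hg : Measurable g) : Measurable fun a => f a ⬝ᵥ g a := by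
  unfold dotProduct
  fun_prop

lemma dotProduct_self_nonneg_real (w : ι → ℝ) : 0 ≤ w ⬝ᵥ w := by
  simpa using dotProduct_star_self_nonneg w

lemma hasLaw_eval_iidGaussian (v : ℝ≥0) (i : ι) :
    HasLaw (fun x : ι → ℝ => x i) (gaussianReal 0 v) (iidGaussian ι v) :=
  ⟨(measurable_pi_apply i).aemeasurable, (measurePreserving_eval _ i).map_eq⟩

lemma measurePreserving_neg_iidGaussian (v : ℝ≥0) :
    MeasurePreserving (fun z : ι → ℝ => -z) (iidGaussian ι v) (iidGaussian ι v) :=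
  measurePreserving_pi _ _ fun _ =>
    ⟨measurable_neg, gaussianReal_map_neg.trans (by rw [neg_zero])⟩

lemma hasGaussianLaw_dotProduct_iidGaussian (v : ℝ≥0) (w : ι → ℝ) :
    HasGaussianLaw (fun x => x ⬝ᵥ w) (iidGaussian ι v) := by
  have hasLaw (i : ι) := gaussianReal_mul_const (hasLaw_eval_iidGaussian v i) (w i)
  exact iIndepFun.hasGaussianLaw_fun_sum (fun i => (hasLaw i).hasGaussianLaw)
    (iIndepFun_pi (X := fun i (x : ℝ) => x * w i) fun i => by fun_prop)

lemma memLp_dotProduct_iidGaussian (v : ℝ≥0) (w : ι → ℝ) {q : ℝ≥0∞} (hq : q ≠ ∞) :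
    MemLp (fun x => x ⬝ᵥ w) q (iidGaussian ι v) :=
  (hasGaussianLaw_dotProduct_iidGaussian v w).memLp hq

lemma integral_dotProduct_iidGaussian (v : ℝ≥0) (w : ι → ℝ) :
    ∫ x, x ⬝ᵥ w ∂iidGaussian ι v = 0 := by
  have hneg := (measurePreserving_neg_iidGaussian v).integral_comp
    (MeasurableEquiv.neg (ι → ℝ)).measurableEmbedding fun x => x ⬝ᵥ w
  simp only [neg_dotProduct, integral_neg] at hneg
  linarith

lemma variance_dotProduct_iidGaussian (v : ℝ≥0) (w : ι → ℝ) :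
    Var[fun x => x ⬝ᵥ w; iidGaussian ι v] = v * (w ⬝ᵥ w) := by
  have sum_eval : (fun x => x ⬝ᵥ w) = ∑ i, fun x : ι → ℝ => x i * w i := by
    ext x
    simp [dotProduct]
  rw [sum_eval, variance_sum_pi (X := fun i (y : ℝ) => y * w i)
    fun i => (memLp_id_gaussianReal 2).mul_const (w i)]
  simp only [variance_mul_const, variance_fun_id_gaussianReal, dotProduct, Finset.mul_sum]
  exact Finset.sum_congr rfl fun i _ => by ring

lemma hasLaw_dotProduct_iidGaussian (v : ℝ≥0) (w : ι → ℝ) :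
    HasLaw (fun x => x ⬝ᵥ w) (gaussianReal 0 (v * (w ⬝ᵥ w).toNNReal)) (iidGaussian ι v) := by
  refine ⟨by fun_prop, ?_⟩
  rw [(hasGaussianLaw_dotProduct_iidGaussian v w).map_eq_gaussianReal,
    integral_dotProduct_iidGaussian, variance_dotProduct_iidGaussian,
    Real.toNNReal_mul v.coe_nonneg, Real.toNNReal_coe]

lemma integral_dotProduct_sq_iidGaussian (v : ℝ≥0) (w : ι → ℝ) :
    ∫ x, (x ⬝ᵥ w) ^ 2 ∂iidGaussian ι v = v * (w ⬝ᵥ w) := by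
  rw [← variance_dotProduct_iidGaussian, variance_of_integral_eq_zero (by fun_prop)
    (integral_dotProduct_iidGaussian v w)]

lemma integral_dotProduct_pow_four_iidGaussian (v : ℝ≥0) (w : ι → ℝ) :
    ∫ x, (x ⬝ᵥ w) ^ 4 ∂iidGaussian ι v = 3 * v ^ 2 * (w ⬝ᵥ w) ^ 2 := by
  have h := (hasLaw_dotProduct_iidGaussian v w).integral_comp (f := fun x => x ^ 4) (by fun_prop)
  simp only [Function.comp_def] at h
  rw [h, integral_pow_four_gaussianReal, NNReal.coe_mul,
    Real.coe_toNNReal _ (dotProduct_self_nonneg_real w)]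
  ring

lemma integral_dotProduct_mul_dotProduct_iidGaussian (v : ℝ≥0) (w w' : ι → ℝ) :
    ∫ x, (x ⬝ᵥ w) * (x ⬝ᵥ w') ∂iidGaussian ι v = v * (w ⬝ᵥ w') := by
  have polarization (x : ι → ℝ) : (x ⬝ᵥ w) * (x ⬝ᵥ w') =
      (1 / 4) * ((x ⬝ᵥ (w + w')) ^ 2 - (x ⬝ᵥ (w - w')) ^ 2) := by
    rw [dotProduct_add, dotProduct_sub]
    ring
  have integrable_sq (u : ι → ℝ) :=
    (memLp_dotProduct_iidGaussian v u ENNReal.ofNat_ne_top).integrable_sq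
  simp only [polarization]
  rw [integral_const_mul, integral_sub (integrable_sq _) (integrable_sq _),
    integral_dotProduct_sq_iidGaussian, integral_dotProduct_sq_iidGaussian]
  simp only [dotProduct_add, dotProduct_sub, add_dotProduct, sub_dotProduct, dotProduct_comm w' w]
  ring

lemma integral_exp_dotProduct_iidGaussian (w : ι → ℝ) :
    ∫ z, Real.exp (z ⬝ᵥ w) ∂iidGaussian ι 1 = Real.exp (w ⬝ᵥ w / 2) := by
  have h := mgf_gaussianReal (hasLaw_dotProduct_iidGaussian 1 w).map_eq 1
  simpa [mgf, dotProduct_self_nonneg_real w] using h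

lemma integrable_exp_dotProduct_iidGaussian (w : ι → ℝ) :
    Integrable (fun z => Real.exp (z ⬝ᵥ w)) (iidGaussian ι 1) := by
  have h := integrable_exp_mul_gaussianReal (μ := 0) (v := 1 * (w ⬝ᵥ w).toNNReal) 1
  rw [← (hasLaw_dotProduct_iidGaussian 1 w).map_eq,
    integrable_map_measure (by fun_prop) (by fun_prop)] at h
  simpa [Function.comp_def] using h

lemma exp_mul_dotProduct_self (t : ℝ) (x : ι → ℝ) :
    Real.exp (t * (x ⬝ᵥ x)) = ∏ i, Real.exp (t * x i ^ 2) := by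
  simp only [← Real.exp_sum, dotProduct, Finset.mul_sum, pow_two]

lemma integrable_exp_mul_dotProduct_self_iidGaussian {v : ℝ≥0} (hv : v ≠ 0) {t : ℝ}
    (ht : 2 * t * v < 1) :
    Integrable (fun x => Real.exp (t * (x ⬝ᵥ x))) (iidGaussian ι v) := by
  simp only [exp_mul_dotProduct_self]
  exact Integrable.fintype_prod fun _ => integrable_exp_mul_sq_gaussianReal hv ht

lemma integral_exp_mul_dotProduct_self_iidGaussian {v : ℝ≥0} (hv : v ≠ 0) {t : ℝ}
    (ht : 2 * t * v < 1) :
    ∫ x, Real.exp (t * (x ⬝ᵥ x)) ∂iidGaussian ι v =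
      (√(1 - 2 * t * v))⁻¹ ^ Fintype.card ι := by
  simp only [exp_mul_dotProduct_self]
  rw [integral_fintype_prod_eq_pow fun x => Real.exp (t * x ^ 2),
    integral_exp_mul_sq_gaussianReal hv ht]

/-- The density at `z` of the law `N(w, I)` with respect to the law `N(0, I)`. -/
noncomputable def likelihoodRatio (w z : ι → ℝ) : ℝ :=
  Real.exp (z ⬝ᵥ w - w ⬝ᵥ w / 2)

lemma likelihoodRatio_nonneg (w z : ι → ℝ) : 0 ≤ likelihoodRatio w z := (Real.exp_pos _).le

@[fun_prop]
lemma measurable_likelihoodRatio (w : ι → ℝ) : Measurable (likelihoodRatio w) := by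
  unfold likelihoodRatio
  fun_prop

lemma gaussianReal_eq_withDensity_standard (w : ℝ) :
    gaussianReal w 1 =
      (gaussianReal 0 1).withDensity fun z => ENNReal.ofReal (Real.exp (z * w - w ^ 2 / 2)) := by
  rw [gaussianReal_of_var_ne_zero _ one_ne_zero, gaussianReal_of_var_ne_zero _ one_ne_zero,
    ← withDensity_mul _ (measurable_gaussianPDF _ _) (by fun_prop)]
  congr 1
  ext z
  simp only [Pi.mul_apply, gaussianPDF, gaussianPDFReal]
  rw [← ENNReal.ofReal_mul (by positivity), mul_assoc _ (Real.exp _), ← Real.exp_add, sub_zero,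
    NNReal.coe_one]
  congr 3
  ring

lemma map_add_iidGaussian (w : ι → ℝ) :
    (iidGaussian ι 1).map (fun z => z + w) =
      (iidGaussian ι 1).withDensity fun z => ENNReal.ofReal (likelihoodRatio w z) := by
  have translate : (iidGaussian ι 1).map (fun z => z + w) =
      Measure.pi fun i => gaussianReal (w i) 1 :=
    (measurePreserving_pi _ _ fun i =>
      ⟨measurable_add_const (w i), by rw [gaussianReal_map_add_const, zero_add]⟩).map_eq
  have density (z : ι → ℝ) : ENNReal.ofReal (likelihoodRatio w z) =
      ∏ i, ENNReal.ofReal (Real.exp (z i * w i - w i ^ 2 / 2)) := by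
    rw [← ENNReal.ofReal_prod_of_nonneg fun _ _ => (Real.exp_pos _).le, ← Real.exp_sum]
    simp only [likelihoodRatio, dotProduct, Finset.sum_sub_distrib, Finset.sum_div, pow_two]
  have (i : ι) : SigmaFinite ((gaussianReal 0 1).withDensity
      fun z => ENNReal.ofReal (Real.exp (z * w i - w i ^ 2 / 2))) := by
    rw [← gaussianReal_eq_withDensity_standard]
    infer_instance
  simp only [translate, density, gaussianReal_eq_withDensity_standard (w _)]
  exact pi_withDensity fun i => by fun_prop

lemma lintegral_add_iidGaussian (w : ι → ℝ) {F : (ι → ℝ) → ℝ≥0∞} (hF : Measurable F) :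
    ∫⁻ z, F (z + w) ∂iidGaussian ι 1 =
      ∫⁻ z, ENNReal.ofReal (likelihoodRatio w z) * F z ∂iidGaussian ι 1 := by
  rw [← lintegral_map hF (by fun_prop), map_add_iidGaussian,
    lintegral_withDensity_eq_lintegral_mul _ (by fun_prop) hF]
  rfl

end GaussianVector

section Resolvent

open scoped InnerProductSpace

variable {E : Type*} [NormedAddCommGroup E] [InnerProductSpace ℝ E] {G : E →ₗ[ℝ] E} {lam : ℝ}

lemma mul_norm_le_of_map_add_smul_eq (hG : G.IsPositive) {d q : E} (h : G d + lam • d = q) :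
    lam * ‖d‖ ≤ ‖q‖ := by
  rcases eq_or_ne d 0 with rfl | hd
  · simp
  have energy : lam * ‖d‖ * ‖d‖ ≤ ‖q‖ * ‖d‖ := by
    have hinner : ⟪q, d⟫_ℝ = ⟪G d, d⟫_ℝ + lam * ‖d‖ ^ 2 := by
      rw [← h, inner_add_left, real_inner_smul_left, real_inner_self_eq_norm_sq]
    linarith [real_inner_le_norm q d, hG.inner_nonneg_left d]
  exact le_of_mul_le_mul_right energy (norm_pos_iff.mpr hd)

/-- The right-hand side is the expansion of `‖(1 + G / lam)⁻¹ β‖ ^ 2` to first order in `G / lam`,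
plus a quadratic error term. -/
lemma norm_sq_le_of_map_add_smul_eq_smul (hG : G.IsPositive) (hlam : 0 < lam) {v β : E}
    (h : G v + lam • v = lam • β) :
    ‖v‖ ^ 2 ≤ ‖β‖ ^ 2 - 2 / lam * ⟪G β, β⟫_ℝ + 3 / lam ^ 2 * ‖G β‖ ^ 2 := by
  obtain ⟨w, rfl⟩ : ∃ w, v = β - w := ⟨β - v, by abel⟩
  have hGv : lam • w = G (β - w) := by
    rw [smul_sub, ← add_sub_assoc, sub_eq_iff_eq_add, add_comm] at h
    exact (add_left_cancel h).symm
  have hw : lam * ‖w‖ ≤ ‖G β‖ := mul_norm_le_of_map_add_smul_eq hG (by rw [hGv, map_sub]; abel)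
  have inner_eq : lam * ⟪β, w⟫_ℝ = ⟪G β, β⟫_ℝ - ⟪G β, w⟫_ℝ := by
    rw [← real_inner_smul_right, hGv, ← hG.isSymmetric, inner_sub_right]
  have cross : lam * ⟪G β, w⟫_ℝ ≤ ‖G β‖ ^ 2 :=
    calc lam * ⟪G β, w⟫_ℝ ≤ lam * (‖G β‖ * ‖w‖) := by gcongr; exact real_inner_le_norm _ _
      _ = ‖G β‖ * (lam * ‖w‖) := by ring
      _ ≤ ‖G β‖ * ‖G β‖ := by gcongr
      _ = ‖G β‖ ^ 2 := by ring
  have square : lam ^ 2 * ‖w‖ ^ 2 ≤ ‖G β‖ ^ 2 := by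
    rw [← mul_pow]
    gcongr
  rw [norm_sub_sq_real, ← sub_nonneg]
  calc 0 ≤ (3 * ‖G β‖ ^ 2 - 2 * (lam * ⟪G β, w⟫_ℝ) - lam ^ 2 * ‖w‖ ^ 2) / lam ^ 2 := by
        apply div_nonneg <;> nlinarith
    _ = _ := by
        rw [show ⟪G β, β⟫_ℝ = lam * ⟪β, w⟫_ℝ + ⟪G β, w⟫_ℝ by linarith]
        field_simp
        ring

/-- Passing to the half sum and the half difference of `e₁` and `e₂` separates the bias `β` from
the noise `q`. -/
lemma norm_sq_add_norm_sq_le_of_map_add_smul_eq (hG : G.IsPositive) (hlam : 0 < lam)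
    {e₁ e₂ β q : E} (h₁ : G e₁ + lam • e₁ = q - lam • β) (h₂ : G e₂ + lam • e₂ = -q - lam • β) :
    ‖e₁‖ ^ 2 + ‖e₂‖ ^ 2 ≤ 2 * (‖β‖ ^ 2 - 2 / lam * ⟪G β, β⟫_ℝ + 3 / lam ^ 2 * ‖G β‖ ^ 2 +
      1 / lam ^ 2 * ‖q‖ ^ 2) := by
  have bias := norm_sq_le_of_map_add_smul_eq_smul hG hlam (v := -((1 / 2 : ℝ) • (e₁ + e₂)))
    (β := β) <| by
      have hsum : G (e₁ + e₂) + lam • (e₁ + e₂) = (-2 : ℝ) • lam • β := by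
        rw [map_add, smul_add, add_add_add_comm, h₁, h₂]
        module
      rw [map_neg, map_smul, smul_neg, smul_comm lam, ← neg_add, ← smul_add, hsum]
      module
  have noise : lam * ‖(1 / 2 : ℝ) • (e₁ - e₂)‖ ≤ ‖q‖ := mul_norm_le_of_map_add_smul_eq hG <| by
    have hdiff : G (e₁ - e₂) + lam • (e₁ - e₂) = (2 : ℝ) • q := by
      rw [map_sub, smul_sub, sub_add_sub_comm, h₁, h₂]
      module
    rw [map_smul, smul_comm lam, ← smul_add, hdiff]
    module
  have noise_sq : ‖(1 / 2 : ℝ) • (e₁ - e₂)‖ ^ 2 ≤ 1 / lam ^ 2 * ‖q‖ ^ 2 := by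
    rw [one_div_mul_eq_div, le_div_iff₀ (by positivity), mul_comm, ← mul_pow]
    gcongr
  rw [norm_neg] at bias
  rw [norm_smul, mul_pow] at bias noise_sq
  norm_num at bias noise_sq ⊢
  linarith [parallelogram_law_with_norm ℝ e₁ e₂]

end Resolvent

section Design

variable {m ι : Type*} [Fintype m]

/-- The score `y ↦ Xᵀ y` of the design with rows `X i`. -/
noncomputable def score (X : m → ι → ℝ) : (m → ℝ) →ₗ[ℝ] EuclideanSpace ℝ ι :=
  (WithLp.linearEquiv 2 ℝ (ι → ℝ)).symm.toLinearMap ∘ₗ (Matrix.of X)ᵀ.mulVecLin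

lemma score_apply (X : m → ι → ℝ) (y : m → ℝ) (j : ι) :
    (score X y).ofLp j = ∑ i, X i j * y i := rfl

variable [Fintype ι]

/-- The Gram operator `b ↦ Xᵀ X b` of the design with rows `X i`. -/
noncomputable def gram (X : m → ι → ℝ) : EuclideanSpace ℝ ι →ₗ[ℝ] EuclideanSpace ℝ ι :=
  score X ∘ₗ (Matrix.of X).mulVecLin ∘ₗ (WithLp.linearEquiv 2 ℝ (ι → ℝ)).toLinearMap

lemma gram_apply (X : m → ι → ℝ) (b : EuclideanSpace ℝ ι) :
    gram X b = score X fun i => X i ⬝ᵥ b.ofLp := rfl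

lemma inner_score (X : m → ι → ℝ) (y : m → ℝ) (b : EuclideanSpace ℝ ι) :
    inner ℝ (score X y) b = ∑ i, y i * (X i ⬝ᵥ b.ofLp) := by
  simp only [PiLp.inner_apply, score_apply, RCLike.inner_apply, conj_trivial, dotProduct,
    Finset.mul_sum]
  rw [Finset.sum_comm]
  exact Finset.sum_congr rfl fun i _ => Finset.sum_congr rfl fun j _ => by ring

lemma inner_gram (X : m → ι → ℝ) (b c : EuclideanSpace ℝ ι) :
    inner ℝ (gram X b) c = ∑ i, (X i ⬝ᵥ b.ofLp) * (X i ⬝ᵥ c.ofLp) := by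
  rw [gram_apply, inner_score]

lemma isPositive_gram (X : m → ι → ℝ) : (gram X).IsPositive := by
  refine ⟨fun b c => ?_, fun b => ?_⟩
  · rw [real_inner_comm _ b, inner_gram, inner_gram]
    exact Finset.sum_congr rfl fun i _ => mul_comm _ _
  · rw [inner_gram]
    exact Finset.sum_nonneg fun i _ => mul_self_nonneg _

/-- An upper bound for the squared bias `‖lam • (gram X + lam)⁻¹ β‖ ^ 2` of the ridge estimator
given the design `X`; see `norm_sq_le_of_map_add_smul_eq_smul`. -/
noncomputable def ridgeSqBiasBound (lam : ℝ) (β : EuclideanSpace ℝ ι) (X : m → ι → ℝ) : ℝ :=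
  ‖β‖ ^ 2 - 2 / lam * inner ℝ (gram X β) β + 3 / lam ^ 2 * ‖gram X β‖ ^ 2

lemma ridgeSqBiasBound_nonneg (lam : ℝ) (β : EuclideanSpace ℝ ι) (X : m → ι → ℝ) :
    0 ≤ ridgeSqBiasBound lam β X := by
  have h : ridgeSqBiasBound lam β X =
      ‖β - lam⁻¹ • gram X β‖ ^ 2 + 2 / lam ^ 2 * ‖gram X β‖ ^ 2 := by
    rw [ridgeSqBiasBound, norm_sub_sq_real, real_inner_smul_right, real_inner_comm, norm_smul,
      mul_pow, Real.norm_eq_abs, sq_abs]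
    ring
  rw [h]
  positivity

end Design

section Ridge

variable {n p : ℕ} {lam : ℝ}

lemma ridgeObjective_add (lam : ℝ) (D : Data n p) (b h : EuclideanSpace ℝ (Fin p)) :
    ridgeObjective lam D (b + h) = ridgeObjective lam D b
      + 2 * inner ℝ (gram D.1 b + lam • b - score D.1 D.2) h
      + (inner ℝ (gram D.1 h) h + lam * ‖h‖ ^ 2) := by
  have expand_sq (i : Fin n) : (D.2 i - (D.1 i ⬝ᵥ b.ofLp + D.1 i ⬝ᵥ h.ofLp)) ^ 2 =
      (D.2 i - D.1 i ⬝ᵥ b.ofLp) ^ 2 - 2 * (D.2 i * (D.1 i ⬝ᵥ h.ofLp)) +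
        2 * ((D.1 i ⬝ᵥ b.ofLp) * (D.1 i ⬝ᵥ h.ofLp)) + (D.1 i ⬝ᵥ h.ofLp) * (D.1 i ⬝ᵥ h.ofLp) := by
    ring
  simp only [ridgeObjective, inner_sub_left, inner_add_left, inner_score, inner_gram,
    real_inner_smul_left, norm_add_sq_real, WithLp.ofLp_add, dotProduct_add, expand_sq,
    Finset.sum_add_distrib, Finset.sum_sub_distrib, ← Finset.mul_sum]
  ring

/-- The ridge estimator in closed form, `(Xᵀ X + lam I)⁻¹ Xᵀ y`. The matrix inverse is the junk
value `0` where `Xᵀ X + lam I` is singular, which does not happen for `0 < lam`. -/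
noncomputable def ridgeEstimator (n p : ℕ) (lam : ℝ) : Estimator n p := fun D =>
  WithLp.toLp 2 (((Matrix.of D.1)ᵀ * Matrix.of D.1 + lam • (1 : Matrix (Fin p) (Fin p) ℝ))⁻¹ *ᵥ
    ((Matrix.of D.1)ᵀ *ᵥ D.2))

lemma gram_ridgeEstimator_add_smul (hlam : 0 < lam) (D : Data n p) :
    gram D.1 (ridgeEstimator n p lam D) + lam • ridgeEstimator n p lam D = score D.1 D.2 := by
  set M := (Matrix.of D.1)ᵀ * Matrix.of D.1 + lam • (1 : Matrix (Fin p) (Fin p) ℝ) with hM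
  have posDef : M.PosDef := by
    refine Matrix.PosDef.posSemidef_add ?_ (Matrix.PosDef.one.smul hlam)
    simpa using Matrix.posSemidef_conjTranspose_mul_self (Matrix.of D.1)
  have gram_add_smul (b : Fin p → ℝ) :
      gram D.1 (WithLp.toLp 2 b) + lam • WithLp.toLp 2 b = WithLp.toLp 2 (M *ᵥ b) := by
    rw [hM, Matrix.add_mulVec, Matrix.smul_mulVec, Matrix.one_mulVec, ← Matrix.mulVec_mulVec]
    rfl
  rw [ridgeEstimator, gram_add_smul, Matrix.mulVec_mulVec,
    Matrix.mul_nonsing_inv _ posDef.det_pos.ne'.isUnit, Matrix.one_mulVec]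
  rfl

lemma ridgeObjective_ridgeEstimator_add_le (hlam : 0 < lam) (D : Data n p)
    (b : EuclideanSpace ℝ (Fin p)) :
    ridgeObjective lam D (ridgeEstimator n p lam D) + lam * ‖b - ridgeEstimator n p lam D‖ ^ 2 ≤
      ridgeObjective lam D b := by
  have h := ridgeObjective_add lam D (ridgeEstimator n p lam D) (b - ridgeEstimator n p lam D)
  rw [add_sub_cancel, gram_ridgeEstimator_add_smul hlam, sub_self, inner_zero_left] at h
  linarith [(isPositive_gram D.1).inner_nonneg_left (b - ridgeEstimator n p lam D)]

lemma isRidgeEstimator_ridgeEstimator (hlam : 0 < lam) :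
    IsRidgeEstimator lam (ridgeEstimator n p lam) := fun D =>
  isMinOn_iff.mpr fun b _ =>
    (le_add_of_nonneg_right (by positivity)).trans (ridgeObjective_ridgeEstimator_add_le hlam D b)

lemma IsRidgeEstimator.eq_ridgeEstimator (hlam : 0 < lam) {est : Estimator n p}
    (hest : IsRidgeEstimator lam est) : est = ridgeEstimator n p lam := by
  funext D
  have hmin := isMinOn_iff.mp (hest D) (ridgeEstimator n p lam D) (Set.mem_univ _)
  have hdist : lam * ‖est D - ridgeEstimator n p lam D‖ ^ 2 ≤ 0 := by
    linarith [ridgeObjective_ridgeEstimator_add_le hlam D (est D)]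
  have hnorm : ‖est D - ridgeEstimator n p lam D‖ ^ 2 = 0 :=
    le_antisymm (nonpos_of_mul_nonpos_right hdist hlam) (sq_nonneg _)
  rwa [sq_eq_zero_iff, norm_sub_eq_zero_iff] at hnorm

lemma measurable_ridgeEstimator (lam : ℝ) : Measurable (ridgeEstimator n p lam) := by
  have hM : Continuous fun D : Data n p =>
      (Matrix.of D.1)ᵀ * Matrix.of D.1 + lam • (1 : Matrix (Fin p) (Fin p) ℝ) := by
    have : Continuous fun D : Data n p => Matrix.of D.1 := continuous_fst
    fun_prop
  refine (WithLp.measurable_toLp 2 _).comp (measurable_pi_lambda _ fun j => ?_)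
  simp only [Matrix.mulVec, dotProduct, Matrix.inv_def, Ring.inverse_eq_inv', Matrix.smul_apply,
    smul_eq_mul, Matrix.transpose_apply, Matrix.of_apply]
  refine Finset.measurable_fun_sum _ fun i _ => Measurable.mul (.mul ?_ ?_) (by fun_prop)
  · exact hM.matrix_det.measurable.inv
  · exact (hM.matrix_adjugate.matrix_elem j i).measurable

lemma gram_ridgeEstimator_sub_add_smul (hlam : 0 < lam) (σ : ℝ) (β : EuclideanSpace ℝ (Fin p))
    (X : Fin n → Fin p → ℝ) (z : Fin n → ℝ) :
    gram X (ridgeEstimator n p lam (X, response σ β X z) - β) +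
      lam • (ridgeEstimator n p lam (X, response σ β X z) - β) = score X (σ • z) - lam • β := by
  have hscore : score X (response σ β X z) = gram X β + score X (σ • z) := by
    rw [gram_apply, ← map_add]
    rfl
  rw [map_sub, smul_sub, sub_add_sub_comm,
    gram_ridgeEstimator_add_smul hlam (X, response σ β X z), hscore]
  abel

lemma norm_sq_ridgeEstimator_sub_add_le (hlam : 0 < lam) (σ : ℝ) (β : EuclideanSpace ℝ (Fin p))
    (X : Fin n → Fin p → ℝ) (z : Fin n → ℝ) :
    ‖ridgeEstimator n p lam (X, response σ β X z) - β‖ ^ 2 +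
      ‖ridgeEstimator n p lam (X, response σ β X (-z)) - β‖ ^ 2 ≤
      2 * (ridgeSqBiasBound lam β X + σ ^ 2 / lam ^ 2 * ‖score X z‖ ^ 2) := by
  refine (norm_sq_add_norm_sq_le_of_map_add_smul_eq (isPositive_gram X) hlam
    (gram_ridgeEstimator_sub_add_smul hlam σ β X z) ?_).trans_eq ?_
  · rw [gram_ridgeEstimator_sub_add_smul hlam σ β X (-z), smul_neg, map_neg]
  · rw [map_smul, norm_smul, mul_pow, Real.norm_eq_abs, sq_abs, ridgeSqBiasBound]
    ring

end Ridge

section IndependentCopies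

variable {m α : Type*} [Fintype m] [MeasurableSpace α] {μ : Measure α} [IsProbabilityMeasure μ]
  {f : α → ℝ}

lemma integrable_sum_eval_pi (hf : Integrable f μ) :
    Integrable (fun X : m → α => ∑ i, f (X i)) (Measure.pi fun _ => μ) :=
  integrable_finsetSum _ fun _ _ => integrable_comp_eval (μ := fun _ => μ) hf

lemma integral_sum_eval_pi (hf : Integrable f μ) :
    ∫ X : m → α, ∑ i, f (X i) ∂Measure.pi (fun _ => μ) = Fintype.card m * ∫ x, f x ∂μ := by
  rw [integral_finsetSum _ fun i _ => integrable_comp_eval (μ := fun _ => μ) hf]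
  simp only [integral_comp_eval (μ := fun _ : m => μ) hf.aestronglyMeasurable,
    Finset.sum_const, Finset.card_univ, nsmul_eq_mul]

lemma memLp_sum_eval_pi {q : ℝ≥0∞} (hf : MemLp f q μ) :
    MemLp (fun X : m → α => ∑ i, f (X i)) q (Measure.pi fun _ => μ) :=
  memLp_finsetSum _ fun i _ => hf.comp_measurePreserving (measurePreserving_eval (fun _ => μ) i)

lemma integral_sum_eval_pi_sq_le (hf : MemLp f 2 μ) :
    ∫ X : m → α, (∑ i, f (X i)) ^ 2 ∂Measure.pi (fun _ => μ) ≤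
      (Fintype.card m * ∫ x, f x ∂μ) ^ 2 + Fintype.card m * ∫ x, f x ^ 2 ∂μ := by
  have variance_decomposition := variance_eq_sub (memLp_sum_eval_pi (m := m) hf)
  have variance_sum : Var[fun X : m → α => ∑ i, f (X i); Measure.pi fun _ => μ] =
      Fintype.card m * Var[f; μ] := by
    have h := variance_sum_pi (ι := m) (μ := fun _ => μ) (X := fun _ => f) fun _ => hf
    simpa [Finset.sum_fn] using h
  have variance_le := mul_le_mul_of_nonneg_left
    (variance_le_expectation_sq hf.aestronglyMeasurable) (Nat.cast_nonneg (Fintype.card m))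
  rw [integral_sum_eval_pi (hf.integrable one_le_two), variance_sum] at variance_decomposition
  simp only [Pi.pow_apply] at variance_decomposition variance_le
  linarith

end IndependentCopies

section GaussianDesign

variable {m ι : Type*} [Fintype m] [Fintype ι]

lemma integrable_dotProduct_pow_four_iidGaussian (v : ℝ≥0) (u : ι → ℝ) :
    Integrable (fun x => (x ⬝ᵥ u) ^ 4) (iidGaussian ι v) := by
  have h := (memLp_dotProduct_iidGaussian v u (q := 4) (by simp)).integrable_norm_pow'
  simpa [Real.norm_eq_abs, (show Even 4 by decide).pow_abs] using h

lemma memLp_dotProduct_mul_dotProduct_iidGaussian (v : ℝ≥0) (u w : ι → ℝ) :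
    MemLp (fun x => (x ⬝ᵥ u) * (x ⬝ᵥ w)) 2 (iidGaussian ι v) := by
  have : ENNReal.HolderTriple 4 4 2 := ⟨by
    rw [← two_mul, show (4 : ℝ≥0∞) = 2 * 2 by norm_num, ENNReal.mul_inv (by simp) (by simp),
      ← mul_assoc, ENNReal.mul_inv_cancel (by simp) (by simp), one_mul]⟩
  exact (memLp_dotProduct_iidGaussian v w (q := 4) (by simp)).mul
    (memLp_dotProduct_iidGaussian v u (q := 4) (by simp))

lemma integral_dotProduct_mul_dotProduct_sq_iidGaussian_le (v : ℝ≥0) (u w : ι → ℝ) :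
    ∫ x, ((x ⬝ᵥ u) * (x ⬝ᵥ w)) ^ 2 ∂iidGaussian ι v ≤ 3 * v ^ 2 * (u ⬝ᵥ u) * (w ⬝ᵥ w) := by
  rcases eq_or_ne u 0 with rfl | hu
  · simp
  rcases eq_or_ne w 0 with rfl | hw
  · simp
  have hu_pos : 0 < u ⬝ᵥ u := (dotProduct_self_nonneg_real u).lt_of_ne' (by simpa using hu)
  have hw_pos : 0 < w ⬝ᵥ w := (dotProduct_self_nonneg_real w).lt_of_ne' (by simpa using hw)
  set a := u ⬝ᵥ u
  set b := w ⬝ᵥ w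
  have hu4 := (integrable_dotProduct_pow_four_iidGaussian v u).const_mul (b ^ 2)
  have hw4 := (integrable_dotProduct_pow_four_iidGaussian v w).const_mul (a ^ 2)
  have am_gm : ∫ x, 2 * a * b * ((x ⬝ᵥ u) * (x ⬝ᵥ w)) ^ 2 ∂iidGaussian ι v ≤
      ∫ x, (b ^ 2 * (x ⬝ᵥ u) ^ 4 + a ^ 2 * (x ⬝ᵥ w) ^ 4) ∂iidGaussian ι v :=
    integral_mono ((memLp_dotProduct_mul_dotProduct_iidGaussian v u w).integrable_sq.const_mul _)
      (hu4.add hw4) fun x => by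
        simp only
        linarith [sq_nonneg (b * (x ⬝ᵥ u) ^ 2 - a * (x ⬝ᵥ w) ^ 2)]
  rw [integral_const_mul, integral_add hu4 hw4, integral_const_mul, integral_const_mul,
    integral_dotProduct_pow_four_iidGaussian, integral_dotProduct_pow_four_iidGaussian] at am_gm
  refine le_of_mul_le_mul_left ?_ (show 0 < 2 * a * b by positivity)
  linarith

/-- The law of a design with rows indexed by `m` and columns indexed by `ι` whose entries are i.i.d.
centred Gaussian with variance `v`. -/
noncomputable abbrev gaussianDesign (m ι : Type*) [Fintype m] [Fintype ι] (v : ℝ≥0) :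
    Measure (m → ι → ℝ) :=
  Measure.pi fun _ => iidGaussian ι v

lemma norm_sq_eq_dotProduct (β : EuclideanSpace ℝ ι) : ‖β‖ ^ 2 = β.ofLp ⬝ᵥ β.ofLp := by
  rw [EuclideanSpace.real_norm_sq_eq]
  simp only [dotProduct, pow_two]

lemma integrable_inner_gram (v : ℝ≥0) (β : EuclideanSpace ℝ ι) :
    Integrable (fun X => inner ℝ (gram X β) β) (gaussianDesign m ι v) := by
  simp only [inner_gram, ← pow_two]
  exact integrable_sum_eval_pi (memLp_dotProduct_iidGaussian _ _ ENNReal.ofNat_ne_top).integrable_sq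

lemma integral_inner_gram (v : ℝ≥0) (β : EuclideanSpace ℝ ι) :
    ∫ X, inner ℝ (gram X β) β ∂gaussianDesign m ι v = Fintype.card m * v * ‖β‖ ^ 2 := by
  simp only [inner_gram, ← pow_two]
  rw [integral_sum_eval_pi
    (memLp_dotProduct_iidGaussian _ _ ENNReal.ofNat_ne_top).integrable_sq,
    integral_dotProduct_sq_iidGaussian, norm_sq_eq_dotProduct, mul_assoc]

lemma norm_sq_gram_eq_sum [DecidableEq ι] (X : m → ι → ℝ) (β : EuclideanSpace ℝ ι) :
    ‖gram X β‖ ^ 2 = ∑ j, (∑ i, (X i ⬝ᵥ Pi.single j 1) * (X i ⬝ᵥ β.ofLp)) ^ 2 := by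
  simp only [EuclideanSpace.real_norm_sq_eq, gram_apply, score_apply, dotProduct_single_one]

lemma integrable_norm_gram_sq (v : ℝ≥0) (β : EuclideanSpace ℝ ι) :
    Integrable (fun X => ‖gram X β‖ ^ 2) (gaussianDesign m ι v) := by
  classical
  simp only [norm_sq_gram_eq_sum]
  exact integrable_finsetSum _ fun j _ => (memLp_sum_eval_pi
    (memLp_dotProduct_mul_dotProduct_iidGaussian v (Pi.single j 1) β.ofLp)).integrable_sq

lemma integral_norm_gram_sq_le (v : ℝ≥0) (β : EuclideanSpace ℝ ι) :
    ∫ X, ‖gram X β‖ ^ 2 ∂gaussianDesign m ι v ≤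
      ((Fintype.card m * v) ^ 2 + 3 * Fintype.card m * Fintype.card ι * v ^ 2) * ‖β‖ ^ 2 := by
  classical
  have memLp_coord (j : ι) :=
    memLp_dotProduct_mul_dotProduct_iidGaussian v (Pi.single j 1) β.ofLp
  have coord_le (j : ι) :
      ∫ X, (∑ i, (X i ⬝ᵥ Pi.single j 1) * (X i ⬝ᵥ β.ofLp)) ^ 2 ∂gaussianDesign m ι v ≤
        (Fintype.card m * v) ^ 2 * β.ofLp j ^ 2 + 3 * Fintype.card m * v ^ 2 * ‖β‖ ^ 2 := by
    have second := integral_dotProduct_mul_dotProduct_sq_iidGaussian_le v (Pi.single j 1) β.ofLp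
    simp only [single_one_dotProduct, Pi.single_eq_same, mul_one, ← norm_sq_eq_dotProduct] at second
    refine (integral_sum_eval_pi_sq_le (memLp_coord j)).trans ?_
    rw [integral_dotProduct_mul_dotProduct_iidGaussian, single_one_dotProduct]
    have := mul_le_mul_of_nonneg_left second (Nat.cast_nonneg (Fintype.card m))
    linarith
  simp only [norm_sq_gram_eq_sum]
  rw [integral_finsetSum _ fun j _ => (memLp_sum_eval_pi (memLp_coord j)).integrable_sq]
  refine (Finset.sum_le_sum fun j _ => coord_le j).trans_eq ?_
  rw [Finset.sum_add_distrib, ← Finset.mul_sum, ← EuclideanSpace.real_norm_sq_eq,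
    Finset.sum_const, Finset.card_univ, nsmul_eq_mul]
  ring

lemma norm_sq_score_eq_sum (X : m → ι → ℝ) (z : m → ℝ) :
    ‖score X z‖ ^ 2 = ∑ j, (z ⬝ᵥ fun i => X i j) ^ 2 := by
  simp only [EuclideanSpace.real_norm_sq_eq, score_apply, dotProduct, mul_comm]

lemma integrable_norm_score_sq (v : ℝ≥0) (X : m → ι → ℝ) :
    Integrable (fun z => ‖score X z‖ ^ 2) (iidGaussian m v) := by
  simp only [norm_sq_score_eq_sum]
  exact integrable_finsetSum _ fun j _ =>
    (memLp_dotProduct_iidGaussian v _ ENNReal.ofNat_ne_top).integrable_sq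

lemma integral_norm_score_sq (v : ℝ≥0) (X : m → ι → ℝ) :
    ∫ z, ‖score X z‖ ^ 2 ∂iidGaussian m v = v * ∑ i, X i ⬝ᵥ X i := by
  simp only [norm_sq_score_eq_sum]
  rw [integral_finsetSum _ fun j _ =>
    (memLp_dotProduct_iidGaussian v _ ENNReal.ofNat_ne_top).integrable_sq]
  simp only [integral_dotProduct_sq_iidGaussian, ← Finset.mul_sum]
  simp only [dotProduct]
  rw [Finset.sum_comm]

lemma integrable_dotProduct_self_iidGaussian (v : ℝ≥0) :
    Integrable (fun x => x ⬝ᵥ x) (iidGaussian ι v) := by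
  simp only [dotProduct, ← pow_two]
  exact integrable_sum_eval_pi (memLp_id_gaussianReal 2).integrable_sq

lemma integral_dotProduct_self_iidGaussian (v : ℝ≥0) :
    ∫ x, x ⬝ᵥ x ∂iidGaussian ι v = Fintype.card ι * v := by
  have second_moment : ∫ x, x ^ 2 ∂gaussianReal 0 v = v := by
    have h := variance_of_integral_eq_zero (μ := gaussianReal 0 v) aemeasurable_id
      integral_id_gaussianReal
    rw [variance_id_gaussianReal] at h
    simpa using h.symm
  simp only [dotProduct, ← pow_two]
  rw [integral_sum_eval_pi (f := fun x => x ^ 2) (memLp_id_gaussianReal 2).integrable_sq,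
    second_moment]

end GaussianDesign

section RidgeRisk

variable {n p : ℕ}

lemma enorm_sq_eq_ofReal {E : Type*} [SeminormedAddCommGroup E] (x : E) :
    ‖x‖ₑ ^ 2 = ENNReal.ofReal (‖x‖ ^ 2) := by
  rw [ENNReal.ofReal_pow (norm_nonneg x), ofReal_norm]

instance isProbabilityMeasure_designLaw : IsProbabilityMeasure (designLaw n p) :=
  inferInstanceAs (IsProbabilityMeasure (gaussianDesign (Fin n) (Fin p) _))

instance isProbabilityMeasure_noiseLaw : IsProbabilityMeasure (noiseLaw n) :=
  inferInstanceAs (IsProbabilityMeasure (iidGaussian (Fin n) 1))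

@[fun_prop]
lemma measurable_response (σ : ℝ) (β : EuclideanSpace ℝ (Fin p)) :
    Measurable fun ω : (Fin n → Fin p → ℝ) × (Fin n → ℝ) => response σ β ω.1 ω.2 := by
  unfold response
  fun_prop

lemma risk_eq_lintegral_lintegral (σ : ℝ) {est : Estimator n p} (hest : Measurable est)
    (β : EuclideanSpace ℝ (Fin p)) :
    risk σ est β =
      ∫⁻ X, ∫⁻ z, ‖est (X, response σ β X z) - β‖ₑ ^ 2 ∂noiseLaw n ∂designLaw n p :=
  lintegral_prod _ (((hest.comp (measurable_fst.prodMk (measurable_response σ β))).sub_const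
    β).enorm.pow_const 2).aemeasurable

lemma lintegral_le_of_add_comp_neg_le {ι : Type*} [Fintype ι] {v : ℝ≥0} {H F : (ι → ℝ) → ℝ≥0∞}
    (hH : Measurable H) (h : ∀ z, H z + H (-z) ≤ 2 * F z) :
    ∫⁻ z, H z ∂iidGaussian ι v ≤ ∫⁻ z, F z ∂iidGaussian ι v := by
  have hneg := (measurePreserving_neg_iidGaussian v).lintegral_comp hH
  have hdouble := lintegral_mono (μ := iidGaussian ι v) h
  rw [lintegral_add_left hH, hneg, ← two_mul, lintegral_const_mul' _ _ ENNReal.ofNat_ne_top]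
    at hdouble
  exact (ENNReal.mul_le_mul_iff_right two_ne_zero ENNReal.ofNat_ne_top).mp hdouble

lemma lintegral_enorm_ridgeEstimator_sub_sq_le {lam : ℝ} (hlam : 0 < lam) (σ : ℝ)
    (β : EuclideanSpace ℝ (Fin p)) (X : Fin n → Fin p → ℝ) :
    ∫⁻ z, ‖ridgeEstimator n p lam (X, response σ β X z) - β‖ₑ ^ 2 ∂noiseLaw n ≤
      ENNReal.ofReal (ridgeSqBiasBound lam β X + σ ^ 2 / lam ^ 2 * ∑ i, X i ⬝ᵥ X i) := by
  have hbias := ridgeSqBiasBound_nonneg lam β X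
  have hnoise := (integrable_norm_score_sq 1 X).const_mul (σ ^ 2 / lam ^ 2)
  have hmeas : Measurable fun z => ‖ridgeEstimator n p lam (X, response σ β X z) - β‖ₑ ^ 2 := by
    have hdata : Measurable fun z => (X, response σ β X z) := by
      unfold response
      fun_prop
    exact (((measurable_ridgeEstimator lam).comp hdata).sub_const β).enorm.pow_const 2
  have symmetrized (z : Fin n → ℝ) :
      ‖ridgeEstimator n p lam (X, response σ β X z) - β‖ₑ ^ 2 +
        ‖ridgeEstimator n p lam (X, response σ β X (-z)) - β‖ₑ ^ 2 ≤
      2 * ENNReal.ofReal (ridgeSqBiasBound lam β X + σ ^ 2 / lam ^ 2 * ‖score X z‖ ^ 2) := by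
    rw [enorm_sq_eq_ofReal, enorm_sq_eq_ofReal,
      ← ENNReal.ofReal_add (by positivity) (by positivity),
      show ∀ a : ℝ, 2 * ENNReal.ofReal a = ENNReal.ofReal (2 * a) from fun a => by
        rw [ENNReal.ofReal_mul zero_le_two, ENNReal.ofReal_ofNat]]
    exact ENNReal.ofReal_le_ofReal (norm_sq_ridgeEstimator_sub_add_le hlam σ β X z)
  refine (lintegral_le_of_add_comp_neg_le hmeas symmetrized).trans_eq ?_
  have hbound : Integrable (fun z => ridgeSqBiasBound lam β X + σ ^ 2 / lam ^ 2 * ‖score X z‖ ^ 2)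
      (iidGaussian (Fin n) 1) := (integrable_const _).add hnoise
  rw [← ofReal_integral_eq_lintegral_ofReal hbound (ae_of_all _ fun z => by positivity),
    integral_add (integrable_const _) hnoise,
    integral_const_mul, integral_norm_score_sq]
  simp

lemma integrable_ridgeSqBiasBound {m ι : Type*} [Fintype m] [Fintype ι] (lam : ℝ) (v : ℝ≥0)
    (β : EuclideanSpace ℝ ι) : Integrable (ridgeSqBiasBound lam β) (gaussianDesign m ι v) :=
  ((integrable_const _).sub ((integrable_inner_gram v β).const_mul _)).add
    ((integrable_norm_gram_sq v β).const_mul _)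

lemma integral_ridgeSqBiasBound_le {m ι : Type*} [Fintype m] [Fintype ι] (lam : ℝ) (v : ℝ≥0)
    (β : EuclideanSpace ℝ ι) :
    ∫ X, ridgeSqBiasBound lam β X ∂gaussianDesign m ι v ≤
      (1 - 2 / lam * (Fintype.card m * v) + 3 / lam ^ 2 * ((Fintype.card m * v) ^ 2 +
        3 * Fintype.card m * Fintype.card ι * v ^ 2)) * ‖β‖ ^ 2 := by
  have hinner := (integrable_inner_gram (m := m) v β).const_mul (2 / lam)
  have hsq := (integrable_norm_gram_sq (m := m) v β).const_mul (3 / lam ^ 2)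
  have hlinear : Integrable (fun X => ‖β‖ ^ 2 - 2 / lam * inner ℝ (gram X β) β)
      (gaussianDesign m ι v) := (integrable_const _).sub hinner
  simp only [ridgeSqBiasBound]
  rw [integral_add hlinear hsq, integral_sub (integrable_const _) hinner,
    integral_const_mul, integral_const_mul, integral_inner_gram]
  have := mul_le_mul_of_nonneg_left (integral_norm_gram_sq_le (m := m) v β)
    (show 0 ≤ 3 / lam ^ 2 by positivity)
  simp only [integral_const, probReal_univ, one_smul]
  linarith

lemma risk_ridgeEstimator_le (hn : n ≠ 0) {lam : ℝ} (hlam : 0 < lam) (σ : ℝ)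
    (β : EuclideanSpace ℝ (Fin p)) :
    risk σ (ridgeEstimator n p lam) β ≤ ENNReal.ofReal
      ((1 - 2 / lam + 3 / lam ^ 2 * (1 + 3 * (p / n))) * ‖β‖ ^ 2 + σ ^ 2 / lam ^ 2 * p) := by
  have hbias := integrable_ridgeSqBiasBound (m := Fin n) lam (n : ℝ≥0)⁻¹ β
  have hnoise := (integrable_sum_eval_pi (m := Fin n)
    (integrable_dotProduct_self_iidGaussian (ι := Fin p) (n : ℝ≥0)⁻¹)).const_mul (σ ^ 2 / lam ^ 2)
  rw [risk_eq_lintegral_lintegral σ (measurable_ridgeEstimator lam) β]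
  refine (lintegral_mono fun X =>
    lintegral_enorm_ridgeEstimator_sub_sq_le hlam σ β X).trans ?_
  have hbound : Integrable (fun X => ridgeSqBiasBound lam β X +
      σ ^ 2 / lam ^ 2 * ∑ i, X i ⬝ᵥ X i) (designLaw n p) := hbias.add hnoise
  rw [← ofReal_integral_eq_lintegral_ofReal hbound (ae_of_all _ fun X =>
    add_nonneg (ridgeSqBiasBound_nonneg lam β X) (mul_nonneg (by positivity)
      (Finset.sum_nonneg fun i _ => dotProduct_self_nonneg_real (X i))))]
  apply ENNReal.ofReal_le_ofReal
  rw [designLaw, integral_add hbias hnoise, integral_const_mul,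
    integral_sum_eval_pi (integrable_dotProduct_self_iidGaussian _),
    integral_dotProduct_self_iidGaussian]
  refine (add_le_add_left (integral_ridgeSqBiasBound_le lam _ β) _).trans_eq ?_
  have hn' : (n : ℝ) ≠ 0 := Nat.cast_ne_zero.mpr hn
  simp only [Fintype.card_fin, NNReal.coe_inv, NNReal.coe_natCast]
  field_simp

/-- The tuning `p σ² / (k τ²)` minimizes the main term `(1 - 2 / lam) k τ² + σ² / lam² p`. -/
lemma supRisk_ridgeEstimator_le (hn : n ≠ 0) (hp : p ≠ 0) {k : ℕ} (hk : k ≠ 0) {τ σ : ℝ}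
    (hτ : 0 < τ) (hσ : 0 < σ) :
    supRisk k τ σ (ridgeEstimator n p (p * σ ^ 2 / (k * τ ^ 2))) ≤
      ENNReal.ofReal (k * τ ^ 2 * (1 - k * τ ^ 2 / (p * σ ^ 2) *
        (1 - 3 * (k * τ ^ 2 / (p * σ ^ 2) + 3 * (k * τ ^ 2 / (n * σ ^ 2)))))) := by
  have hn' : (n : ℝ) ≠ 0 := Nat.cast_ne_zero.mpr hn
  have hp' : (p : ℝ) ≠ 0 := Nat.cast_ne_zero.mpr hp
  have hk' : (k : ℝ) ≠ 0 := Nat.cast_ne_zero.mpr hk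
  set lam : ℝ := p * σ ^ 2 / (k * τ ^ 2) with lam_def
  have hlam : 0 < lam := by positivity
  have bias_factor_nonneg : 0 ≤ 1 - 2 / lam + 3 / lam ^ 2 * (1 + 3 * (p / n) : ℝ) :=
    calc 0 ≤ (1 - 1 / lam) ^ 2 + 2 / lam ^ 2 + 9 * (p / n) / lam ^ 2 := by positivity
      _ = _ := by ring
  refine iSup₂_le fun β hβ => (risk_ridgeEstimator_le hn hlam σ β).trans ?_
  apply ENNReal.ofReal_le_ofReal
  calc _ ≤ (1 - 2 / lam + 3 / lam ^ 2 * (1 + 3 * (p / n))) * (k * τ ^ 2) +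
        σ ^ 2 / lam ^ 2 * p := by gcongr; exact hβ.2
    _ = _ := by
      rw [lam_def]
      field_simp
      ring

end RidgeRisk

section BayesRisk

lemma ofReal_integral_le_lintegral_ofReal {α : Type*} [MeasurableSpace α] {μ : Measure α}
    (f : α → ℝ) : ENNReal.ofReal (∫ a, f a ∂μ) ≤ ∫⁻ a, ENNReal.ofReal (f a) ∂μ := by
  by_cases hf : Integrable f μ
  · rw [integral_eq_lintegral_pos_part_sub_lintegral_neg_part hf]
    exact (ENNReal.ofReal_le_ofReal (sub_le_self _ ENNReal.toReal_nonneg)).trans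
      ENNReal.ofReal_toReal_le
  · simp [integral_undef hf]

variable {ι V E : Type*} [Fintype ι] [Fintype V]

lemma integrable_likelihoodRatio (w : ι → ℝ) :
    Integrable (likelihoodRatio w) (iidGaussian ι 1) := by
  unfold likelihoodRatio
  simp only [Real.exp_sub]
  exact (integrable_exp_dotProduct_iidGaussian w).div_const _

lemma integral_likelihoodRatio (w : ι → ℝ) :
    ∫ z, likelihoodRatio w z ∂iidGaussian ι 1 = 1 := by
  simp only [likelihoodRatio, Real.exp_sub]
  rw [integral_div, integral_exp_dotProduct_iidGaussian, div_self (Real.exp_ne_zero _)]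

lemma likelihoodRatio_mul_likelihoodRatio (w w' z : ι → ℝ) :
    likelihoodRatio w z * likelihoodRatio w' z =
      Real.exp (w ⬝ᵥ w') * likelihoodRatio (w + w') z := by
  simp only [likelihoodRatio, ← Real.exp_add, dotProduct_add, add_dotProduct,
    dotProduct_comm w' w]
  ring_nf

lemma lintegral_enorm_comp_add_sub_sq [NormedAddCommGroup E] [MeasurableSpace E] [BorelSpace E]
    (w : ι → ℝ) (θ : E) {e : (ι → ℝ) → E} (he : Measurable e) :
    ∫⁻ z, ‖e (z + w) - θ‖ₑ ^ 2 ∂iidGaussian ι 1 =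
      ∫⁻ z, ENNReal.ofReal (likelihoodRatio w z * ‖e z - θ‖ ^ 2) ∂iidGaussian ι 1 := by
  rw [lintegral_add_iidGaussian w (F := fun z => ‖e z - θ‖ₑ ^ 2)
    ((he.sub_const θ).enorm.pow_const 2)]
  simp only [enorm_sq_eq_ofReal, ENNReal.ofReal_mul (likelihoodRatio_nonneg _ _)]

variable [NormedAddCommGroup E] [InnerProductSpace ℝ E]

open scoped InnerProductSpace

/-- Completing the square: the minimum over `e` of the right-hand side is attained at the weighted
mean of the `θ v`. -/
lemma sum_mul_norm_sq_sub_le {P : V → ℝ} (hP : ∀ v, 0 ≤ P v) {B : ℝ} (hB : 1 ≤ B * ∑ v, P v)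
    (θ : V → E) (e : E) :
    ∑ v, P v * ‖θ v‖ ^ 2 - B * ‖∑ v, P v • θ v‖ ^ 2 ≤ ∑ v, P v * ‖e - θ v‖ ^ 2 := by
  set F := ∑ v, P v
  set T := ∑ v, P v • θ v with hT
  have expand : ∑ v, P v * ‖e - θ v‖ ^ 2 =
      F * ‖e‖ ^ 2 - 2 * ⟪e, T⟫_ℝ + ∑ v, P v * ‖θ v‖ ^ 2 := by
    simp only [hT, inner_sum, real_inner_smul_right, norm_sub_sq_real, mul_add, mul_sub,
      Finset.sum_add_distrib, Finset.sum_sub_distrib, Finset.mul_sum, Finset.sum_mul, F]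
    simp only [mul_left_comm]
  have hF : 0 < F := by
    refine (Finset.sum_nonneg fun v _ => hP v).lt_of_ne' fun h => ?_
    rw [show F = 0 from h, mul_zero] at hB
    exact hB.not_gt one_pos
  have square : 0 ≤ F * (F * ‖e‖ ^ 2 - 2 * ⟪e, T⟫_ℝ + B * ‖T‖ ^ 2) := by
    have h := norm_sub_sq_real (F • e) T
    rw [norm_smul, Real.norm_of_nonneg hF.le, real_inner_smul_left] at h
    nlinarith [sq_nonneg ‖F • e - T‖, mul_nonneg (sub_nonneg.mpr hB) (sq_nonneg ‖T‖)]
  linarith [nonneg_of_mul_nonneg_right square hF]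

lemma norm_sq_sum_smul (P : V → ℝ) (θ : V → E) :
    ‖∑ v, P v • θ v‖ ^ 2 = ∑ v, ∑ v', P v * P v' * ⟪θ v, θ v'⟫_ℝ := by
  rw [← real_inner_self_eq_norm_sq]
  simp only [sum_inner, inner_sum, real_inner_smul_left, real_inner_smul_right, mul_assoc,
    real_inner_comm (θ _) (θ _)]

lemma integral_sum_likelihoodRatio_mul_sub (w : V → ι → ℝ) (θ : V → E) (B : ℝ) :
    ∫ z, (∑ v, likelihoodRatio (w v) z * ‖θ v‖ ^ 2 -
        B * ‖∑ v, likelihoodRatio (w v) z • θ v‖ ^ 2) ∂iidGaussian ι 1 =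
      ∑ v, ‖θ v‖ ^ 2 - B * ∑ v, ∑ v', Real.exp (w v ⬝ᵥ w v') * ⟪θ v, θ v'⟫_ℝ := by
  have hfirst (v : V) := (integrable_likelihoodRatio (w v)).mul_const (‖θ v‖ ^ 2)
  have hsecond (v v' : V) := ((integrable_likelihoodRatio (w v + w v')).const_mul
    (Real.exp (w v ⬝ᵥ w v'))).mul_const ⟪θ v, θ v'⟫_ℝ
  have hsecond_sum (v : V) := integrable_finsetSum Finset.univ fun v' _ => hsecond v v'
  simp only [norm_sq_sum_smul, likelihoodRatio_mul_likelihoodRatio]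
  rw [integral_sub (integrable_finsetSum _ fun v _ => hfirst v)
    ((integrable_finsetSum _ fun v _ => hsecond_sum v).const_mul B), integral_const_mul,
    integral_finsetSum _ fun v _ => hfirst v, integral_finsetSum _ fun v _ => hsecond_sum v]
  simp only [integral_finsetSum _ fun v' _ => hsecond _ v', integral_mul_const,
    integral_const_mul, integral_likelihoodRatio, one_mul, mul_one]

/-- A lower bound for the Bayes risk, up to the factor `Fintype.card V`, when the mean `w v` of
`N(w v, I)` encodes the parameter `θ v` and `v` is uniform on `V`. -/
lemma ofReal_le_sum_lintegral_enorm_sub_sq [MeasurableSpace E] [BorelSpace E]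
    (w : V → ι → ℝ) (θ : V → E) {B : ℝ}
    (hB : ∀ z, 1 ≤ B * ∑ v, likelihoodRatio (w v) z) {e : (ι → ℝ) → E} (he : Measurable e) :
    ENNReal.ofReal (∑ v, ‖θ v‖ ^ 2 - B * ∑ v, ∑ v', Real.exp (w v ⬝ᵥ w v') * ⟪θ v, θ v'⟫_ℝ) ≤
      ∑ v, ∫⁻ z, ‖e (z + w v) - θ v‖ₑ ^ 2 ∂iidGaussian ι 1 := by
  have hloss_nonneg (z : ι → ℝ) (v : V) : 0 ≤ likelihoodRatio (w v) z * ‖e z - θ v‖ ^ 2 :=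
    mul_nonneg (likelihoodRatio_nonneg _ _) (sq_nonneg _)
  have hloss (v : V) :
      Measurable fun z => ENNReal.ofReal (likelihoodRatio (w v) z * ‖e z - θ v‖ ^ 2) :=
    ((measurable_likelihoodRatio (w v)).mul
      ((he.sub_const (θ v)).norm.pow_const 2)).ennreal_ofReal
  simp only [lintegral_enorm_comp_add_sub_sq _ _ he]
  rw [← lintegral_finsetSum _ fun v _ => hloss v, ← integral_sum_likelihoodRatio_mul_sub]
  refine (ofReal_integral_le_lintegral_ofReal _).trans (lintegral_mono fun z => ?_)
  rw [← ENNReal.ofReal_sum_of_nonneg fun v _ => hloss_nonneg z v]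
  exact ENNReal.ofReal_le_ofReal
    (sum_mul_norm_sq_sub_le (fun v => likelihoodRatio_nonneg _ _) (hB z) θ (e z))

end BayesRisk

section SignedPrior

variable {J ι : Type*} [Fintype J] [Fintype ι]

lemma sum_units_int {M : Type*} [AddCommMonoid M] (g : ℤˣ → M) : ∑ s, g s = g 1 + g (-1) := by
  rw [UnitsInt.univ, Finset.sum_pair (by decide)]

lemma sum_sinh_mul_sum_exp_le (u : J → ℝ) :
    (∑ j, Real.sinh (u j)) * ∑ j, Real.exp (u j / 2) ≤
      Fintype.card J * ∑ j, Real.sinh (u j) * Real.exp (u j / 2) := by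
  refine Monovary.sum_mul_sum_le_card_mul_sum fun i j hij => Real.sinh_le_sinh.mpr ?_
  linarith [Real.exp_lt_exp.mp hij]

lemma sq_card_le_sum_exp_neg_mul_sum_exp (u : J → ℝ) :
    (Fintype.card J : ℝ) ^ 2 ≤ (∑ j, Real.exp (-u j)) * ∑ j, Real.exp (u j) := by
  have h := Finset.sum_sq_le_sum_mul_sum_of_sq_le_mul Finset.univ
    (r := fun _ : J => (1 : ℝ)) (f := fun j => Real.exp (-u j)) (g := fun j => Real.exp (u j))
    (fun j _ => (Real.exp_pos _).le) (fun j _ => (Real.exp_pos _).le)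
    (fun j _ => by simp [← Real.exp_add])
  simpa using h

lemma two_mul_exp_le_likelihoodRatio_add_neg (w z : ι → ℝ) :
    2 * Real.exp (-(w ⬝ᵥ w / 2)) ≤ likelihoodRatio w z + likelihoodRatio (-w) z := by
  have h : likelihoodRatio w z + likelihoodRatio (-w) z =
      2 * Real.cosh (z ⬝ᵥ w) * Real.exp (-(w ⬝ᵥ w / 2)) := by
    simp only [likelihoodRatio, dotProduct_neg, neg_dotProduct, neg_neg, sub_eq_add_neg,
      Real.exp_add, Real.cosh_eq]
    ring
  rw [h]
  gcongr
  linarith [Real.one_le_cosh (z ⬝ᵥ w)]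

variable [DecidableEq J]

lemma sum_sum_exp_mul_inner_signed_single (w : J → ι → ℝ) (t : ℝ) :
    ∑ v : J × ℤˣ, ∑ v' : J × ℤˣ, Real.exp ((v.2 • w v.1) ⬝ᵥ (v'.2 • w v'.1)) *
        inner ℝ (v.2 • EuclideanSpace.single v.1 t) (v'.2 • EuclideanSpace.single v'.1 t) =
      4 * t ^ 2 * ∑ j, Real.sinh (w j ⬝ᵥ w j) := by
  have inner_single (i j : J) : inner ℝ (EuclideanSpace.single i t) (EuclideanSpace.single j t) =
      if i = j then t ^ 2 else 0 := by
    rw [EuclideanSpace.inner_single_left, PiLp.single_apply]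
    split_ifs <;> simp [pow_two]
  have signs (i j : J) : ∑ s : ℤˣ, ∑ s' : ℤˣ, Real.exp ((s • w i) ⬝ᵥ (s' • w j)) *
      inner ℝ (s • EuclideanSpace.single i t) (s' • EuclideanSpace.single j t) =
        if i = j then 4 * t ^ 2 * Real.sinh (w i ⬝ᵥ w j) else 0 := by
    simp only [sum_units_int, one_smul, Units.neg_smul, inner_neg_left, inner_neg_right,
      inner_single, neg_dotProduct, dotProduct_neg, neg_neg, Real.sinh_eq]
    split_ifs <;> ring
  simp only [Fintype.sum_prod_type, Finset.mul_sum]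
  refine Finset.sum_congr rfl fun j _ => ?_
  rw [Finset.sum_comm]
  simp only [signs, Finset.sum_ite_eq, Finset.mem_univ, if_true]

lemma ofReal_le_sum_lintegral_enorm_sub_signed_single_sq [Nonempty J] (w : J → ι → ℝ) (t : ℝ)
    {e : (ι → ℝ) → EuclideanSpace ℝ J} (he : Measurable e) :
    ENNReal.ofReal (2 * Fintype.card J * t ^ 2 - 2 * t ^ 2 / Fintype.card J *
        ∑ j, Real.sinh (w j ⬝ᵥ w j) * Real.exp (w j ⬝ᵥ w j / 2)) ≤
      ∑ v : J × ℤˣ, ∫⁻ z, ‖e (z + v.2 • w v.1) - v.2 • EuclideanSpace.single v.1 t‖ₑ ^ 2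
        ∂iidGaussian ι 1 := by
  set m : ℝ := (Fintype.card J : ℝ)
  have hm : 0 < m := Nat.cast_pos.mpr Fintype.card_pos
  set S := ∑ j, Real.exp (w j ⬝ᵥ w j / 2)
  have hS : 0 ≤ S := Finset.sum_nonneg fun j _ => (Real.exp_pos _).le
  have mass (z : ι → ℝ) :
      1 ≤ S / (2 * m ^ 2) * ∑ v : J × ℤˣ, likelihoodRatio (v.2 • w v.1) z := by
    have hlik : 2 * ∑ j, Real.exp (-(w j ⬝ᵥ w j / 2)) ≤
        ∑ v : J × ℤˣ, likelihoodRatio (v.2 • w v.1) z := by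
      rw [Finset.mul_sum, Fintype.sum_prod_type]
      refine Finset.sum_le_sum fun j _ => ?_
      simpa only [sum_units_int, one_smul, Units.neg_smul] using
        two_mul_exp_le_likelihoodRatio_add_neg (w j) z
    rw [div_mul_eq_mul_div, one_le_div (by positivity)]
    have := sq_card_le_sum_exp_neg_mul_sum_exp fun j => w j ⬝ᵥ w j / 2
    linarith [mul_le_mul_of_nonneg_left hlik hS]
  refine le_trans (ENNReal.ofReal_le_ofReal ?_) (ofReal_le_sum_lintegral_enorm_sub_sq
    (fun v : J × ℤˣ => v.2 • w v.1) (fun v => v.2 • EuclideanSpace.single v.1 t) mass he)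
  have energy : ∑ v : J × ℤˣ, ‖v.2 • EuclideanSpace.single v.1 t‖ ^ 2 = 2 * m * t ^ 2 := by
    simp only [Fintype.sum_prod_type, sum_units_int, one_smul, Units.neg_smul, norm_neg,
      PiLp.norm_single, Real.norm_eq_abs, sq_abs, Finset.sum_const, Finset.card_univ,
      nsmul_eq_mul]
    ring
  rw [energy, sum_sum_exp_mul_inner_signed_single]
  have chebyshev := sum_sinh_mul_sum_exp_le fun j => w j ⬝ᵥ w j
  calc _ = 2 * m * t ^ 2 - 2 * t ^ 2 / m ^ 2 *
        (m * ∑ j, Real.sinh (w j ⬝ᵥ w j) * Real.exp (w j ⬝ᵥ w j / 2)) := by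
        field_simp
    _ ≤ 2 * m * t ^ 2 - 2 * t ^ 2 / m ^ 2 * ((∑ j, Real.sinh (w j ⬝ᵥ w j)) * S) := by gcongr
    _ = _ := by
        field_simp
        ring

end SignedPrior

section ColumnMoments

lemma inv_sqrt_one_sub_le_exp {x : ℝ} (hx : x ≤ 1 / 2) :
    (√(1 - x))⁻¹ ≤ Real.exp (x / 2 + x ^ 2) := by
  have hx₁ : 0 < 1 - x := by linarith
  rw [← Real.sqrt_inv, show x / 2 + x ^ 2 = (x + 2 * x ^ 2) / 2 by ring, Real.exp_half]
  refine Real.sqrt_le_sqrt (le_trans ?_ (Real.add_one_le_exp _))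
  rw [inv_le_iff_one_le_mul₀ hx₁]
  nlinarith [mul_nonneg (sq_nonneg x) (show 0 ≤ 1 - 2 * x by linarith)]

lemma exp_neg_le_inv_sqrt_one_add {x : ℝ} (hx : 0 ≤ x) :
    Real.exp (-(x / 2)) ≤ (√(1 + x))⁻¹ := by
  rw [Real.exp_neg, Real.exp_half]
  gcongr
  linarith [Real.add_one_le_exp x]

lemma exp_sub_exp_div_two_le {x : ℝ} (hx₀ : 0 ≤ x) (hx : x ≤ 1 / 6) :
    (Real.exp (3 / 2 * x + 9 * x ^ 2) - Real.exp (-(x / 2))) / 2 ≤ x * (1 + 9 * x) := by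
  have hquad : 9 * x ^ 2 ≤ 3 / 2 * x := by nlinarith
  have hupper := (abs_le.mp (Real.abs_exp_sub_one_sub_id_le (x := 3 / 2 * x + 9 * x ^ 2)
    (abs_le.mpr ⟨by nlinarith, by nlinarith⟩))).2
  nlinarith [Real.add_one_le_exp (-(x / 2))]

lemma sinh_mul_exp_half (r s : ℝ) :
    Real.sinh (r * s) * Real.exp (r * s / 2) =
      (Real.exp (3 / 2 * r * s) - Real.exp (-(1 / 2 * r) * s)) / 2 := by
  rw [Real.sinh_eq, div_mul_eq_mul_div, sub_mul, ← Real.exp_add, ← Real.exp_add]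
  ring_nf

variable {ι : Type*} [Fintype ι] {v : ℝ≥0} {r : ℝ}

lemma integral_exp_mul_dotProduct_self_iidGaussian_le (hv : v ≠ 0) (hr : r * v ≤ 1 / 4) :
    ∫ x : ι → ℝ, Real.exp (r * (x ⬝ᵥ x)) ∂iidGaussian ι v ≤
      Real.exp (Fintype.card ι * (r * v + (2 * r * v) ^ 2)) := by
  rw [integral_exp_mul_dotProduct_self_iidGaussian hv (by linarith), Real.exp_nat_mul]
  gcongr
  refine (inv_sqrt_one_sub_le_exp (by linarith)).trans_eq ?_
  rw [mul_assoc 2 r, mul_div_cancel_left₀ _ two_ne_zero]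

lemma exp_neg_le_integral_exp_neg_mul_dotProduct_self_iidGaussian (hv : v ≠ 0) (hr : 0 ≤ r) :
    Real.exp (-(Fintype.card ι * (r * v))) ≤
      ∫ x : ι → ℝ, Real.exp (-r * (x ⬝ᵥ x)) ∂iidGaussian ι v := by
  have hrv : 0 ≤ r * v := by positivity
  rw [integral_exp_mul_dotProduct_self_iidGaussian hv (by linarith), ← mul_neg, Real.exp_nat_mul]
  gcongr
  rw [show 1 - 2 * -r * v = 1 + 2 * (r * v) by ring]
  refine le_of_eq_of_le ?_ (exp_neg_le_inv_sqrt_one_add (by linarith))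
  rw [mul_div_cancel_left₀ _ two_ne_zero]

lemma integrable_sinh_mul_exp_dotProduct_self_iidGaussian (hv : v ≠ 0) (hr₀ : 0 ≤ r)
    (hr : 3 * r * v < 1) :
    Integrable (fun x : ι → ℝ => Real.sinh (r * (x ⬝ᵥ x)) * Real.exp (r * (x ⬝ᵥ x) / 2))
      (iidGaussian ι v) := by
  have hrv : 0 ≤ r * v := by positivity
  simp only [sinh_mul_exp_half]
  exact ((integrable_exp_mul_dotProduct_self_iidGaussian hv (by linarith)).sub
    (integrable_exp_mul_dotProduct_self_iidGaussian hv (by linarith))).div_const 2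

lemma integral_sinh_mul_exp_dotProduct_self_iidGaussian_le [Nonempty ι] (hv : v ≠ 0) (hr₀ : 0 ≤ r)
    {s : ℝ} (hs : Fintype.card ι * (r * v) = s) (hs₆ : s ≤ 1 / 6) :
    ∫ x : ι → ℝ, Real.sinh (r * (x ⬝ᵥ x)) * Real.exp (r * (x ⬝ᵥ x) / 2) ∂iidGaussian ι v ≤
      s * (1 + 9 * s) := by
  have hrv₀ : 0 ≤ r * v := by positivity
  have hcard : (1 : ℝ) ≤ Fintype.card ι := Nat.one_le_cast.mpr Fintype.card_pos
  have hrv : r * v ≤ s := hs ▸ le_mul_of_one_le_left hrv₀ hcard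
  have hpos : ∫ x : ι → ℝ, Real.exp (3 / 2 * r * (x ⬝ᵥ x)) ∂iidGaussian ι v ≤
      Real.exp (3 / 2 * s + 9 * s ^ 2) := by
    refine (integral_exp_mul_dotProduct_self_iidGaussian_le hv (by linarith)).trans ?_
    gcongr
    calc Fintype.card ι * (3 / 2 * r * v + (2 * (3 / 2 * r) * v) ^ 2) =
          3 / 2 * (Fintype.card ι * (r * v)) + 9 * (Fintype.card ι * (r * v) * (r * v)) := by ring
      _ ≤ 3 / 2 * s + 9 * (s * s) := by
        rw [hs]
        gcongr
        exact hrv₀.trans hrv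
      _ = _ := by ring
  have hneg : Real.exp (-(s / 2)) ≤
      ∫ x : ι → ℝ, Real.exp (-(1 / 2 * r) * (x ⬝ᵥ x)) ∂iidGaussian ι v := by
    refine le_of_eq_of_le ?_ (exp_neg_le_integral_exp_neg_mul_dotProduct_self_iidGaussian hv
      (show 0 ≤ 1 / 2 * r by positivity))
    rw [← hs]
    ring_nf
  simp only [sinh_mul_exp_half]
  rw [integral_div, integral_sub
      (integrable_exp_mul_dotProduct_self_iidGaussian hv (by linarith))
      (integrable_exp_mul_dotProduct_self_iidGaussian hv (by linarith))]
  refine le_trans ?_ (exp_sub_exp_div_two_le (hrv₀.trans hrv) hs₆)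
  gcongr

end ColumnMoments

section BlockRisk

variable {n p : ℕ} {J : Type*}

lemma measurePreserving_column (j : Fin p) :
    MeasurePreserving (fun (X : Fin n → Fin p → ℝ) i => X i j) (designLaw n p)
      (iidGaussian (Fin n) (n : ℝ≥0)⁻¹) :=
  measurePreserving_pi _ _ fun _ => measurePreserving_eval _ j

lemma integrable_sinh_mul_exp_column (hn : n ≠ 0) (j : Fin p) {x : ℝ} (hx₀ : 0 ≤ x)
    (hx : 3 * x < 1) :
    Integrable (fun X => Real.sinh (x * ((fun i => X i j) ⬝ᵥ fun i => X i j)) *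
      Real.exp (x * ((fun i => X i j) ⬝ᵥ fun i => X i j) / 2)) (designLaw n p) := by
  refine (measurePreserving_column j).integrable_comp_of_integrable
    (integrable_sinh_mul_exp_dotProduct_self_iidGaussian (inv_ne_zero (Nat.cast_ne_zero.mpr hn))
      hx₀ ?_)
  have hn₁ : (1 : ℝ) ≤ n := Nat.one_le_cast.mpr (Nat.pos_of_ne_zero hn)
  rw [NNReal.coe_inv, NNReal.coe_natCast]
  exact (mul_le_of_le_one_right (by positivity) (inv_le_one_of_one_le₀ hn₁)).trans_lt hx

lemma integral_sinh_mul_exp_column_le (hn : n ≠ 0) (j : Fin p) {x : ℝ} (hx₀ : 0 ≤ x)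
    (hx : x ≤ 1 / 6) :
    ∫ X, Real.sinh (x * ((fun i => X i j) ⬝ᵥ fun i => X i j)) *
      Real.exp (x * ((fun i => X i j) ⬝ᵥ fun i => X i j) / 2) ∂designLaw n p ≤
        x * (1 + 9 * x) := by
  have : Nonempty (Fin n) := Fin.pos_iff_nonempty.mp (Nat.pos_of_ne_zero hn)
  have hv : (n : ℝ≥0)⁻¹ ≠ 0 := inv_ne_zero (Nat.cast_ne_zero.mpr hn)
  have hunit : Fintype.card (Fin n) * (x * (n : ℝ≥0)⁻¹) = x := by
    simp [mul_left_comm, hn]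
  have h := integral_sinh_mul_exp_dotProduct_self_iidGaussian_le hv hx₀ hunit hx
  rwa [← (measurePreserving_column j).map_eq, integral_map
    (measurePreserving_column j).measurable.aemeasurable (by fun_prop)] at h

/-- The subvector of `b` formed by the coordinates `φ j`. -/
noncomputable def subvector (φ : J → Fin p) (b : EuclideanSpace ℝ (Fin p)) :
    EuclideanSpace ℝ J :=
  WithLp.toLp 2 (b.ofLp ∘ φ)

lemma subvector_sub (φ : J → Fin p) (b c : EuclideanSpace ℝ (Fin p)) :
    subvector φ (b - c) = subvector φ b - subvector φ c :=
  rfl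

lemma measurable_subvector (φ : J → Fin p) : Measurable (subvector φ) := by
  unfold subvector
  fun_prop

lemma response_add_smul_single {σ : ℝ} (hσ : σ ≠ 0) (β : EuclideanSpace ℝ (Fin p)) (s : ℤˣ)
    (j : Fin p) (t : ℝ) (X : Fin n → Fin p → ℝ) (z : Fin n → ℝ) :
    response σ (β + s • EuclideanSpace.single j t) X z =
      response σ β X (z + s • (t / σ) • fun i => X i j) := by
  ext i
  rcases Int.units_eq_one_or s with rfl | rfl <;>
  · simp only [response, one_smul, Units.neg_smul, WithLp.ofLp_add, WithLp.ofLp_neg,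
      PiLp.ofLp_single, dotProduct_add, dotProduct_neg, dotProduct_single, Pi.add_apply,
      Pi.neg_apply, Pi.smul_apply, smul_eq_mul]
    field_simp
    ring

variable [Fintype J]

lemma measurable_subvector_loss (φ : J → Fin p) (σ : ℝ) {est : Estimator n p}
    (hest : Measurable est) (β : EuclideanSpace ℝ (Fin p)) (θ : EuclideanSpace ℝ J) :
    Measurable fun ω : (Fin n → Fin p → ℝ) × (Fin n → ℝ) =>
      ‖subvector φ (est (ω.1, response σ β ω.1 ω.2)) - θ‖ₑ ^ 2 :=
  (((measurable_subvector φ).comp (hest.comp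
    (measurable_fst.prodMk (measurable_response σ β)))).sub_const θ).enorm.pow_const 2

variable [DecidableEq J] [Nonempty J]

lemma ofReal_le_sum_lintegral_subvector_loss (φ : J → Fin p) {σ : ℝ} (hσ : σ ≠ 0) (t : ℝ)
    {est : Estimator n p} (hest : Measurable est) (β : EuclideanSpace ℝ (Fin p))
    (X : Fin n → Fin p → ℝ) :
    ENNReal.ofReal (2 * Fintype.card J * t ^ 2 - 2 * t ^ 2 / Fintype.card J *
        ∑ j, Real.sinh ((t / σ) ^ 2 * ((fun i => X i (φ j)) ⬝ᵥ fun i => X i (φ j))) *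
          Real.exp ((t / σ) ^ 2 * ((fun i => X i (φ j)) ⬝ᵥ fun i => X i (φ j)) / 2)) ≤
      ∑ v : J × ℤˣ, ∫⁻ z, ‖subvector φ (est (X, response σ
        (β + v.2 • EuclideanSpace.single (φ v.1) t) X z)) - v.2 • EuclideanSpace.single v.1 t‖ₑ ^ 2
          ∂noiseLaw n := by
  have hmeas : Measurable fun z => subvector φ (est (X, response σ β X z)) :=
    (measurable_subvector φ).comp (hest.comp
      (measurable_const.prodMk ((measurable_response σ β).comp measurable_prodMk_left)))
  have h := ofReal_le_sum_lintegral_enorm_sub_signed_single_sq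
    (fun j => (t / σ) • fun i => X i (φ j)) t hmeas
  simpa only [dotProduct_smul, smul_dotProduct, smul_eq_mul, ← mul_assoc, ← pow_two,
    response_add_smul_single hσ, noiseLaw] using h

/-- Up to the factor `Fintype.card (J × ℤˣ)`, this bounds the Bayes risk of the subvector indexed by
`J` for the uniform prior on its signed spikes of size `t`. -/
lemma card_nsmul_le_sum_lintegral_subvector_loss (hn : n ≠ 0) (φ : J → Fin p) {σ : ℝ}
    (hσ : σ ≠ 0) {t : ℝ} (ht : (t / σ) ^ 2 ≤ 1 / 6) {est : Estimator n p} (hest : Measurable est)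
    (β : EuclideanSpace ℝ (Fin p)) :
    Fintype.card (J × ℤˣ) • ENNReal.ofReal
        (t ^ 2 * (1 - (t / σ) ^ 2 * (1 + 9 * (t / σ) ^ 2) / Fintype.card J)) ≤
      ∑ v : J × ℤˣ, ∫⁻ ω, ‖subvector φ (est (ω.1, response σ
        (β + v.2 • EuclideanSpace.single (φ v.1) t) ω.1 ω.2)) -
          v.2 • EuclideanSpace.single v.1 t‖ₑ ^ 2 ∂(designLaw n p).prod (noiseLaw n) := by
  have hmeas (v : J × ℤˣ) := measurable_subvector_loss φ σ hest
    (β + v.2 • EuclideanSpace.single (φ v.1) t) (v.2 • EuclideanSpace.single v.1 t)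
  simp only [fun v => lintegral_prod _ (hmeas v).aemeasurable (μ := designLaw n p)
    (ν := noiseLaw n)]
  rw [← lintegral_finsetSum _ fun v _ => (hmeas v).lintegral_prod_right']
  refine le_trans ?_ (lintegral_mono fun X =>
    ofReal_le_sum_lintegral_subvector_loss φ hσ t hest β X)
  refine le_trans ?_ (ofReal_integral_le_lintegral_ofReal _)
  set m : ℝ := (Fintype.card J : ℝ) with hm
  set x := (t / σ) ^ 2
  have hint (j : J) := integrable_sinh_mul_exp_column hn (φ j) (sq_nonneg (t / σ))
    (show 3 * x < 1 by linarith)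
  have hcolumns := Finset.sum_le_card_nsmul Finset.univ _ _ fun j _ =>
    integral_sinh_mul_exp_column_le hn (φ j) (sq_nonneg (t / σ)) ht
  rw [Finset.card_univ, nsmul_eq_mul, ← hm] at hcolumns
  rw [← ENNReal.ofReal_nsmul]
  refine ENNReal.ofReal_le_ofReal ?_
  rw [integral_sub (integrable_const _)
    ((integrable_finsetSum _ fun j _ => hint j).const_mul _), integral_const_mul (2 * t ^ 2 / m),
    integral_finsetSum _ fun j _ => hint j, integral_const, probReal_univ, one_smul]
  have hm₀ : 0 < m := Nat.cast_pos.mpr Fintype.card_pos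
  calc _ = 2 * m * t ^ 2 - 2 * t ^ 2 / m * (m * (x * (1 + 9 * x))) := by
        simp only [Fintype.card_prod, Fintype.card_units_int, nsmul_eq_mul]
        push_cast
        rw [← hm]
        field_simp
    _ ≤ _ := by gcongr

end BlockRisk

section Averaging

variable {κ : Type*} [Fintype κ] [DecidableEq κ] {V : κ → Type*} [∀ l, Fintype (V l)]

lemma sum_sum_update {M : Type*} [AddCommMonoid M] (f : (∀ l, V l) → M) (l : κ) :
    ∑ c, ∑ v, f (Function.update c l v) = Fintype.card (V l) • ∑ c, f c := by
  have swap : Function.Involutive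
      fun x : (∀ l, V l) × V l => (Function.update x.1 l x.2, x.1 l) := by
    intro x
    simp only [Function.update_idem, Function.update_eq_self, Function.update_self]
  rw [← Fintype.sum_prod_type' (f := fun c v => f (Function.update c l v)),
    Fintype.sum_equiv swap.toPerm _ (fun x => f x.1) fun x => (by rfl), Fintype.sum_prod_type]
  simp only [Finset.sum_const, Finset.card_univ, Finset.smul_sum]

lemma card_nsmul_le_sum_of_card_nsmul_le_sum_update [∀ l, Nonempty (V l)]
    {g : (∀ l, V l) → ℝ≥0∞} {l : κ} {b : ℝ≥0∞}
    (hb : ∀ c, Fintype.card (V l) • b ≤ ∑ v, g (Function.update c l v)) :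
    Fintype.card (∀ l, V l) • b ≤ ∑ c, g c := by
  have h := Finset.card_nsmul_le_sum Finset.univ _ _ fun c _ => hb c
  rw [sum_sum_update, smul_comm, Finset.card_univ, nsmul_eq_mul, nsmul_eq_mul (Fintype.card (V l))]
    at h
  exact (ENNReal.mul_le_mul_iff_right (Nat.cast_ne_zero.mpr Fintype.card_ne_zero)
    (ENNReal.natCast_ne_top _)).mp h

lemma sum_le_of_card_nsmul_le_sum_update [∀ l, Nonempty (V l)] {g : κ → (∀ l, V l) → ℝ≥0∞}
    {b : κ → ℝ≥0∞} {R : ℝ≥0∞}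
    (hb : ∀ l c, Fintype.card (V l) • b l ≤ ∑ v, g l (Function.update c l v))
    (hR : ∀ c, ∑ l, g l c ≤ R) : ∑ l, b l ≤ R := by
  have h : Fintype.card (∀ l, V l) • ∑ l, b l ≤ Fintype.card (∀ l, V l) • R := by
    calc _ ≤ ∑ l, ∑ c, g l c := by
          rw [Finset.smul_sum]
          exact Finset.sum_le_sum fun l _ => card_nsmul_le_sum_of_card_nsmul_le_sum_update (hb l)
      _ = ∑ c, ∑ l, g l c := Finset.sum_comm
      _ ≤ _ := Finset.sum_le_card_nsmul _ _ _ fun c _ => hR c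
  rw [nsmul_eq_mul, nsmul_eq_mul] at h
  exact (ENNReal.mul_le_mul_iff_right (Nat.cast_ne_zero.mpr Fintype.card_ne_zero)
    (ENNReal.natCast_ne_top _)).mp h

end Averaging

section BlockPrior

variable {n p k : ℕ} {κ : Type*} [Fintype κ] {J : κ → Type*} (φ : (Σ l, J l) ↪ Fin p) (t : κ → ℝ)

/-- The sparse vector with a single spike in each of the disjoint blocks `φ ⟨l, ·⟩`: the choice
`c l` consists of the position of the spike of size `t l` and of its sign. -/
noncomputable def blockVector (c : ∀ l, J l × ℤˣ) : EuclideanSpace ℝ (Fin p) :=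
  ∑ l, (c l).2 • EuclideanSpace.single (φ ⟨l, (c l).1⟩) (t l)

lemma hammingNorm_blockVector_le (c : ∀ l, J l × ℤˣ) :
    hammingNorm (blockVector φ t c).ofLp ≤ Fintype.card κ := by
  have hsupport : (Finset.univ.filter fun i => (blockVector φ t c).ofLp i ≠ 0) ⊆
      Finset.univ.image fun l => φ ⟨l, (c l).1⟩ := by
    intro i hi
    simp only [blockVector, WithLp.ofLp_sum, Finset.sum_apply, Finset.mem_filter, Finset.mem_univ,
      true_and] at hi
    obtain ⟨l, -, hl⟩ := Finset.exists_ne_zero_of_sum_ne_zero hi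
    refine Finset.mem_image.mpr ⟨l, Finset.mem_univ l, ?_⟩
    by_contra hne
    exact hl (by simp [Pi.single_eq_of_ne' hne])
  exact (Finset.card_le_card hsupport).trans Finset.card_image_le

lemma norm_sq_blockVector (c : ∀ l, J l × ℤˣ) : ‖blockVector φ t c‖ ^ 2 = ∑ l, t l ^ 2 := by
  have hcoord : blockVector φ t c = ∑ l, (((c l).2 : ℤ) * t l : ℝ) •
      EuclideanSpace.basisFun (Fin p) ℝ (φ ⟨l, (c l).1⟩) := by
    refine Finset.sum_congr rfl fun l _ => ?_
    rcases Int.units_eq_one_or (c l).2 with h | h <;>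
      ext i <;> simp [h]
  have horth := (EuclideanSpace.basisFun (Fin p) ℝ).orthonormal.comp
    (fun l => φ ⟨l, (c l).1⟩) fun l l' h => congrArg Sigma.fst (φ.injective h)
  rw [← real_inner_self_eq_norm_sq, hcoord]
  refine (horth.inner_sum _ _ _).trans (Finset.sum_congr rfl fun l _ => ?_)
  rcases Int.units_eq_one_or (c l).2 with h | h <;> simp [h, pow_two]

lemma blockVector_mem_paramSpace {τ : ℝ} (hcard : Fintype.card κ ≤ k)
    (ht : ∑ l, t l ^ 2 ≤ k * τ ^ 2) (c : ∀ l, J l × ℤˣ) :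
    blockVector φ t c ∈ paramSpace p k τ :=
  ⟨(hammingNorm_blockVector_le φ t c).trans hcard, (norm_sq_blockVector φ t c).trans_le ht⟩

lemma sum_enorm_subvector_sq_le [∀ l, Fintype (J l)] (b : EuclideanSpace ℝ (Fin p)) :
    ∑ l, ‖subvector (fun j => φ ⟨l, j⟩) b‖ₑ ^ 2 ≤ ‖b‖ₑ ^ 2 := by
  simp only [enorm_sq_eq_ofReal, EuclideanSpace.real_norm_sq_eq]
  rw [← ENNReal.ofReal_sum_of_nonneg fun l _ => Finset.sum_nonneg fun j _ => sq_nonneg _]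
  refine ENNReal.ofReal_le_ofReal ?_
  simp only [subvector, Function.comp_apply]
  rw [← Fintype.sum_sigma' (fun l j => b.ofLp (φ ⟨l, j⟩) ^ 2),
    ← Finset.sum_map Finset.univ φ fun i => b.ofLp i ^ 2]
  exact Finset.sum_le_univ_sum_of_nonneg fun i => sq_nonneg _

lemma subvector_blockVector [∀ l, DecidableEq (J l)] (c : ∀ l, J l × ℤˣ) (l : κ) :
    subvector (fun j => φ ⟨l, j⟩) (blockVector φ t c) =
      (c l).2 • EuclideanSpace.single (c l).1 (t l) := by
  ext j
  simp only [subvector, blockVector, WithLp.ofLp_sum, Finset.sum_apply, Function.comp_apply]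
  rw [Finset.sum_eq_single l]
  · rcases Int.units_eq_one_or (c l).2 with h | h <;> simp [h]
  · intro l' _ hl
    simp [hl.symm]
  · exact fun h => absurd (Finset.mem_univ l) h

lemma blockVector_update [DecidableEq κ] (c : ∀ l, J l × ℤˣ) (l : κ) (v : J l × ℤˣ) :
    blockVector φ t (Function.update c l v) =
      ∑ l' ∈ Finset.univ.erase l, (c l').2 • EuclideanSpace.single (φ ⟨l', (c l').1⟩) (t l') +
        v.2 • EuclideanSpace.single (φ ⟨l, v.1⟩) (t l) := by
  rw [blockVector, ← Finset.sum_erase_add _ _ (Finset.mem_univ l), Function.update_self]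
  congr 1
  refine Finset.sum_congr rfl fun l' hl' => ?_
  rw [Function.update_of_ne (Finset.ne_of_mem_erase hl')]

lemma ofReal_sum_le_supRisk [∀ l, Fintype (J l)] [∀ l, Nonempty (J l)] (φ : (Σ l, J l) ↪ Fin p)
    (t : κ → ℝ) (hn : n ≠ 0) {σ τ : ℝ} (hσ : σ ≠ 0) (hcard : Fintype.card κ ≤ k)
    (ht : ∑ l, t l ^ 2 ≤ k * τ ^ 2) (htσ : ∀ l, (t l / σ) ^ 2 ≤ 1 / 6)
    {est : Estimator n p} (hest : Measurable est) :
    ENNReal.ofReal (∑ l, t l ^ 2 * (1 - (t l / σ) ^ 2 * (1 + 9 * (t l / σ) ^ 2) /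
      Fintype.card (J l))) ≤ supRisk k τ σ est := by
  classical
  refine (Finset.le_sum_of_subadditive ENNReal.ofReal ENNReal.ofReal_zero.le
    (fun _ _ => ENNReal.ofReal_add_le) _ _).trans ?_
  refine sum_le_of_card_nsmul_le_sum_update (V := fun l => J l × ℤˣ)
    (g := fun l c => ∫⁻ ω, ‖subvector (fun j => φ ⟨l, j⟩)
      (est (ω.1, response σ (blockVector φ t c) ω.1 ω.2)) -
        (c l).2 • EuclideanSpace.single (c l).1 (t l)‖ₑ ^ 2 ∂(designLaw n p).prod (noiseLaw n))
    (fun l c => ?_) (fun c => ?_)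
  · simp only [blockVector_update, Function.update_self]
    exact card_nsmul_le_sum_lintegral_subvector_loss hn _ hσ (htσ l) hest _
  · have hmeas (l : κ) := measurable_subvector_loss (fun j => φ ⟨l, j⟩) σ hest (blockVector φ t c)
      ((c l).2 • EuclideanSpace.single (c l).1 (t l))
    have hrisk : risk σ est (blockVector φ t c) ≤ supRisk k τ σ est :=
      le_iSup₂ (f := fun β (_ : β ∈ paramSpace p k τ) => risk σ est β) _
        (blockVector_mem_paramSpace φ t hcard ht c)
    rw [← lintegral_finsetSum _ fun l _ => hmeas l]
    refine (lintegral_mono fun ω => ?_).trans hrisk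
    simp only [← subvector_blockVector φ t c, ← subvector_sub]
    exact sum_enorm_subvector_sq_le φ _

end BlockPrior

section BalancedBlocks

variable {n p k : ℕ}

/-- Spreading the energy evenly over the coordinates, `t l ^ 2 = a * Fintype.card (J l)`, makes the
relative loss in every block the same up to second-order terms. -/
lemma ofReal_le_snrMinimaxRisk_of_blocks {κ : Type*} [Fintype κ] {J : κ → Type*}
    [∀ l, Fintype (J l)] [∀ l, Nonempty (J l)] (φ : (Σ l, J l) ↪ Fin p) (hn : n ≠ 0) {σ τ a s : ℝ}
    (hσ : σ ≠ 0) (ha₀ : 0 ≤ a) (hcard : Fintype.card κ ≤ k)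
    (ha : Fintype.card (Σ l, J l) * a ≤ k * τ ^ 2)
    (has : ∀ l, a / σ ^ 2 * Fintype.card (J l) ≤ s) (hs : s ≤ 1 / 6) :
    ENNReal.ofReal (Fintype.card (Σ l, J l) * a * (1 - a / σ ^ 2 * (1 + 9 * s))) ≤
      snrMinimaxRisk n p k τ σ := by
  set t : κ → ℝ := fun l => √(a * Fintype.card (J l))
  have hsq (l : κ) : t l ^ 2 = a * Fintype.card (J l) := Real.sq_sqrt (by positivity)
  have hsnr (l : κ) : (t l / σ) ^ 2 = a / σ ^ 2 * Fintype.card (J l) := by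
    rw [div_pow, hsq, mul_div_right_comm]
  have htotal : ∑ l, t l ^ 2 = Fintype.card (Σ l, J l) * a := by
    simp only [hsq, ← Finset.mul_sum, Fintype.card_sigma, Nat.cast_sum, mul_comm]
  refine le_iInf₂ fun est hest => le_trans (ENNReal.ofReal_le_ofReal ?_)
    (ofReal_sum_le_supRisk φ t hn hσ hcard (htotal.trans_le ha)
      (fun l => (hsnr l).trans_le ((has l).trans hs)) hest)
  rw [← htotal, Finset.sum_mul]
  refine Finset.sum_le_sum fun l _ => mul_le_mul_of_nonneg_left ?_ (sq_nonneg _)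
  have hm : (Fintype.card (J l) : ℝ) ≠ 0 := Nat.cast_ne_zero.mpr Fintype.card_ne_zero
  rw [hsnr, mul_right_comm, mul_div_cancel_right₀ _ hm]
  gcongr
  exact has l

lemma mul_div_min_add_one_le (hp : p ≠ 0) (hk : k ≠ 0) {b : ℝ} (hb : 0 ≤ b) :
    k * b / p * ((p / min k p : ℕ) + 1) ≤ b + 2 * (k * b / p) := by
  have : (0 : ℝ) < p := Nat.cast_pos.mpr (Nat.pos_of_ne_zero hp)
  have : (0 : ℝ) < k := Nat.cast_pos.mpr (Nat.pos_of_ne_zero hk)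
  rcases le_total k p with hkp | hpk
  · rw [min_eq_left hkp]
    have hfloor : k * b / p * (p / k : ℕ) ≤ b := by
      calc k * b / p * (p / k : ℕ) ≤ k * b / p * (p / k) := by gcongr; exact Nat.cast_div_le
        _ = b := by field_simp
    have : 0 ≤ k * b / p := by positivity
    linarith
  · rw [min_eq_right hpk, Nat.div_self (Nat.pos_of_ne_zero hp), Nat.cast_one]
    linarith

/-- The blocks form an equipartition of the coordinates; `min k p` of them rather than `k`, since
`k` may exceed `p`. -/
lemma ofReal_le_snrMinimaxRisk (hn : n ≠ 0) (hp : p ≠ 0) (hk : k ≠ 0) {σ τ : ℝ} (hσ : σ ≠ 0)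
    (hs : (τ / σ) ^ 2 + 2 * (k * τ ^ 2 / (p * σ ^ 2)) ≤ 1 / 6) :
    ENNReal.ofReal (k * τ ^ 2 * (1 - k * τ ^ 2 / (p * σ ^ 2) *
      (1 + 9 * ((τ / σ) ^ 2 + 2 * (k * τ ^ 2 / (p * σ ^ 2)))))) ≤ snrMinimaxRisk n p k τ σ := by
  have hp₀ : (p : ℝ) ≠ 0 := Nat.cast_ne_zero.mpr hp
  have hq : min k p ≠ 0 := by omega
  obtain ⟨P, hequi, hparts⟩ := Finpartition.exists_equipartition_card_eq
    (Finset.univ : Finset (Fin p)) hq (by simp)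
  have (l : P.parts) : Nonempty l.1 := (P.nonempty_of_mem_parts l.2).to_subtype
  let φ : (Σ l : P.parts, l.1) ↪ Fin p :=
    P.equivSigmaParts.symm.toEmbedding.trans (Function.Embedding.subtype _)
  have htotal : Fintype.card (Σ l : P.parts, l.1) = p := by
    rw [← Fintype.card_congr P.equivSigmaParts]
    simp
  have henergy : (p : ℝ) * (k * τ ^ 2 / p) = k * τ ^ 2 := mul_div_cancel₀ _ hp₀
  have hrate : k * τ ^ 2 / p / σ ^ 2 = k * τ ^ 2 / (p * σ ^ 2) := div_div _ _ _
  have hblock (l : P.parts) : k * τ ^ 2 / p / σ ^ 2 * Fintype.card l.1 ≤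
      (τ / σ) ^ 2 + 2 * (k * τ ^ 2 / (p * σ ^ 2)) := by
    have hcard := hequi.card_part_le_average_add_one l.2
    rw [hparts, Finset.card_univ, Fintype.card_fin] at hcard
    have hsnr : k * τ ^ 2 / (p * σ ^ 2) = k * (τ / σ) ^ 2 / p := by
      rw [div_pow]
      field_simp
    rw [hrate, hsnr, Fintype.card_coe]
    refine le_trans ?_ (mul_div_min_add_one_le hp hk (sq_nonneg (τ / σ)))
    gcongr
    exact_mod_cast hcard
  have hcard : Fintype.card P.parts ≤ k := by
    rw [Fintype.card_coe, hparts]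
    exact min_le_left k p
  have h := ofReal_le_snrMinimaxRisk_of_blocks φ hn hσ (by positivity) hcard
    (by rw [htotal, henergy]) hblock hs
  rwa [htotal, henergy, hrate] at h

lemma snrMinimaxRisk_le_supRisk_ridgeEstimator (lam τ σ : ℝ) :
    snrMinimaxRisk n p k τ σ ≤ supRisk k τ σ (ridgeEstimator n p lam) :=
  iInf₂_le _ (measurable_ridgeEstimator lam)

end BalancedBlocks

section Asymptotics

lemma exists_tendsto_zero_eq_mul_one_sub_mul {R : ℕ → ℝ≥0∞} {L r e₁ e₂ : ℕ → ℝ}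
    (hL : ∀ n, 0 < L n) (hr : ∀ n, 0 < r n) (hr₀ : Tendsto r atTop (𝓝 0))
    (he₁ : Tendsto e₁ atTop (𝓝 0)) (he₂ : Tendsto e₂ atTop (𝓝 0))
    (hlower : ∀ᶠ n in atTop, ENNReal.ofReal (L n * (1 - r n * (1 + e₁ n))) ≤ R n)
    (hupper : ∀ᶠ n in atTop, R n ≤ ENNReal.ofReal (L n * (1 - r n * (1 - e₂ n)))) :
    ∃ δ : ℕ → ℝ, Tendsto δ atTop (𝓝 0) ∧
      ∀ᶠ n in atTop, R n = ENNReal.ofReal (L n * (1 - r n * (1 + δ n))) := by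
  have hfinite : ∀ᶠ n in atTop, R n ≠ ∞ :=
    hupper.mono fun n hn => ne_top_of_le_ne_top ENNReal.ofReal_ne_top hn
  have hmain : ∀ᶠ n in atTop, r n * (1 - e₂ n) < 1 := by
    have h : Tendsto (fun n => r n * (1 - e₂ n)) atTop (𝓝 0) := by
      simpa only [sub_zero, mul_one] using hr₀.mul (he₂.const_sub 1)
    exact h.eventually_lt_const one_pos
  refine ⟨fun n => (1 - (R n).toReal / L n) / r n - 1, ?_, ?_⟩
  · refine tendsto_of_tendsto_of_tendsto_of_le_of_le' (by simpa only [neg_zero] using he₂.neg) he₁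
      ?_ ?_
    · filter_upwards [hupper, hmain] with n hn hn₁
      have h := ENNReal.toReal_le_of_le_ofReal (mul_nonneg (hL n).le (by linarith)) hn
      rw [← div_le_iff₀' (hL n)] at h
      rw [neg_le_sub_iff_le_add, ← sub_le_iff_le_add, le_div_iff₀ (hr n)]
      linarith
    · filter_upwards [hlower, hfinite] with n hn hn₁
      have h := (ENNReal.ofReal_le_iff_le_toReal hn₁).mp hn
      rw [← le_div_iff₀' (hL n)] at h
      rw [sub_le_iff_le_add', div_le_iff₀ (hr n)]
      linarith
  · filter_upwards [hfinite] with n hn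
    rw [add_sub_cancel, mul_div_cancel₀ _ (hr n).ne', sub_sub_cancel, mul_div_cancel₀ _ (hL n).ne',
      ENNReal.ofReal_toReal hn]

end Asymptotics

end SparseRegression

theorem mainTheorem3_general (p k : ℕ → ℕ) (τ σ : ℕ → ℝ)
    (hp : ∀ n, 0 < p n) (hk : ∀ n, 0 < k n) (hτ : ∀ n, 0 < τ n) (hσ : ∀ n, 0 < σ n)
    (hkp : Tendsto (fun n => k n * τ n ^ 2 / (p n * σ n ^ 2)) atTop (𝓝 0))
    (hkn : Tendsto (fun n => k n * τ n ^ 2 / (n * σ n ^ 2)) atTop (𝓝 0))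
    (hτσ : Tendsto (fun n => τ n / σ n) atTop (𝓝 0)) :
    (∃ δ : ℕ → ℝ, Tendsto δ atTop (𝓝 0) ∧ ∀ᶠ n in atTop,
      SparseRegression.snrMinimaxRisk n (p n) (k n) (τ n) (σ n) =
        ENNReal.ofReal (k n * τ n ^ 2 *
          (1 - k n * τ n ^ 2 / (p n * σ n ^ 2) * (1 + δ n)))) ∧
    (∃ δ : ℕ → ℝ, Tendsto δ atTop (𝓝 0) ∧ ∀ᶠ n in atTop,
      (∃ est : SparseRegression.Estimator n (p n), Measurable est ∧
        SparseRegression.IsRidgeEstimator (p n * σ n ^ 2 / (k n * τ n ^ 2)) est) ∧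
      ∀ est : SparseRegression.Estimator n (p n),
        SparseRegression.IsRidgeEstimator (p n * σ n ^ 2 / (k n * τ n ^ 2)) est →
        SparseRegression.supRisk (k n) (τ n) (σ n) est =
          ENNReal.ofReal (k n * τ n ^ 2 *
            (1 - k n * τ n ^ 2 / (p n * σ n ^ 2) * (1 + δ n)))) := by
  have henergy (n) : 0 < k n * τ n ^ 2 := mul_pos (Nat.cast_pos.mpr (hk n)) (pow_pos (hτ n) 2)
  have hnoise (n) : 0 < p n * σ n ^ 2 := mul_pos (Nat.cast_pos.mpr (hp n)) (pow_pos (hσ n) 2)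
  have hratio (n) : 0 < k n * τ n ^ 2 / (p n * σ n ^ 2) := div_pos (henergy n) (hnoise n)
  have hlam (n) : 0 < p n * σ n ^ 2 / (k n * τ n ^ 2) := div_pos (hnoise n) (henergy n)
  have hsnr : Tendsto (fun n => (τ n / σ n) ^ 2 + 2 * (k n * τ n ^ 2 / (p n * σ n ^ 2)))
      atTop (𝓝 0) := by simpa using (hτσ.pow 2).add (hkp.const_mul 2)
  have he₁ := by simpa only [mul_zero] using hsnr.const_mul 9
  have he₂ := by simpa only [mul_zero, add_zero] using (hkp.add (hkn.const_mul 3)).const_mul 3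
  have hlower := (hsnr.eventually_le_const (by norm_num : (0 : ℝ) < 1 / 6)).and
    (eventually_ne_atTop 0) |>.mono fun n hn => SparseRegression.ofReal_le_snrMinimaxRisk
      hn.2 (hp n).ne' (hk n).ne' (hσ n).ne' hn.1
  have hupper := (eventually_ne_atTop 0).mono fun n hn => SparseRegression.supRisk_ridgeEstimator_le
    hn (hp n).ne' (hk n).ne' (hτ n) (hσ n)
  have hmid (n) := SparseRegression.snrMinimaxRisk_le_supRisk_ridgeEstimator (n := n) (p := p n)
    (k := k n) (p n * σ n ^ 2 / (k n * τ n ^ 2)) (τ n) (σ n)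
  refine ⟨SparseRegression.exists_tendsto_zero_eq_mul_one_sub_mul henergy hratio hkp he₁ he₂ hlower
    (hupper.mono fun n hn => (hmid n).trans hn), ?_⟩
  obtain ⟨δ, hδ, hrisk⟩ := SparseRegression.exists_tendsto_zero_eq_mul_one_sub_mul henergy hratio
    hkp he₁ he₂ (hlower.mono fun n hn => hn.trans (hmid n)) hupper
  refine ⟨δ, hδ, hrisk.mono fun n hn => ⟨⟨_, SparseRegression.measurable_ridgeEstimator _,
    SparseRegression.isRidgeEstimator_ridgeEstimator (hlam n)⟩, fun est hest => ?_⟩⟩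
  rw [hest.eq_ridgeEstimator (hlam n), hn]

theorem mainTheorem3 (p k : ℕ → ℕ) (τ σ : ℕ → ℝ)
    (hp : ∀ n, 0 < p n) (hk : ∀ n, 0 < k n) (hτ : ∀ n, 0 < τ n) (hσ : ∀ n, 0 < σ n)
    (hkp : Tendsto (fun n => (k n : ℝ) / (p n : ℝ)) atTop (𝓝 0))
    (hkn : Tendsto (fun n => (k n : ℝ) / (n : ℝ)) atTop (𝓝 0))
    (hτσ : Tendsto (fun n => τ n / σ n) atTop (𝓝 0)) :
    (∃ δ : ℕ → ℝ, Tendsto δ atTop (𝓝 0) ∧ ∀ᶠ n in atTop,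
      SparseRegression.snrMinimaxRisk n (p n) (k n) (τ n) (σ n) =
        ENNReal.ofReal (k n * τ n ^ 2 *
          (1 - k n * τ n ^ 2 / (p n * σ n ^ 2) * (1 + δ n)))) ∧
    (∃ δ : ℕ → ℝ, Tendsto δ atTop (𝓝 0) ∧ ∀ᶠ n in atTop,
      (∃ est : SparseRegression.Estimator n (p n), Measurable est ∧
        SparseRegression.IsRidgeEstimator (p n * σ n ^ 2 / (k n * τ n ^ 2)) est) ∧
      ∀ est : SparseRegression.Estimator n (p n),
        SparseRegression.IsRidgeEstimator (p n * σ n ^ 2 / (k n * τ n ^ 2)) est →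
        SparseRegression.supRisk (k n) (τ n) (σ n) est =
          ENNReal.ofReal (k n * τ n ^ 2 *
            (1 - k n * τ n ^ 2 / (p n * σ n ^ 2) * (1 + δ n)))) := by
  have hkp' := by simpa [div_pow, div_mul_div_comm] using hkp.mul (hτσ.pow 2)
  have hkn' := by simpa [div_pow, div_mul_div_comm] using hkn.mul (hτσ.pow 2)
  exact mainTheorem3_general p k τ σ hp hk hτ hσ hkp' hkn' hτσ
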